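/- Let $\Gamma$ be a finite simple graph with vertex set $I$. For each $i\in I$ let $G_i$ be a group acting transitively on a nonempty set $E_i$, regarded as a rank-one building (any two distinct chambers are $i$-adjacent). Let $E=\prod_{i\in I}E_i$, with the componentwise action of $\prod_{i\in I} G_i$. *Graph product of the $E_i$.* Let $W_\Gamma$ be the right-angled Coxeter group with generating set $I$, where $m(i,j)=2$ if $\{i,j\}$ is an edge and $m(i,j)=\infty$ for other pairs $i\ne j$. Call $T\subseteq I$ spherical if the subgroup of $W_\Gamma$ generated by $T$ is finite, and let $K$ be the Davis chamber, i.e. the geometric realization of the poset of spherical subsets. Its $i$-mirror $K_i$ is the realization of the subposet of those spherical subsets that contain $i$. Let $\mathcal R=(E\times K)/\!\sim$, with $E$ discrete, where $(C,x)\sim(D,y)$ if and only if $x=y$ and $C_i=D_i$ for all $i$ with $x\notin K_i$. Let $q:X\to\mathcal R$ be a universal cover (a covering map with $X$ simply connected). The set $\widetilde E$ of chambers of the graph product $\prod_\Gamma E_i$ is the set of copies of $K$ in $X$, i.e. of the lifts to $X$ of the maps $K\to\mathcal R$, $x\mapsto[C,x]$, for $C\in E$; let $p:\widetilde E\to E$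 send such a lift to $C$. Two chambers are $i$-equivalent if they agree on the $i$-mirror. A $T$-residue is a class of chambers joined by galleries of type $T$, i.e. by chains of chambers in which consecutive ones are $i$-equivalent for some $i\in T$. An automorphism of $\widetilde E$ is a permutation of $\widetilde E$ that preserves $i$-equivalence in both directions, for every $i$. Let $\widetilde G$ be the group of all lifts to $\widetilde E$ of the action of $\prod_I G_i$ on $E$, i.e. of all automorphisms $\varphi$ of $\widetilde E$ such that $p\circ\varphi=g\circ p$ for some $g\in\prod_I G_i$. *Generalized graph product of the $G_i$.* Fix $C=(C_i)_{i\in I}\in E$ and let $B_i$ be the stabilizer of $C_i$ in $G_i$. For $T\subseteq I$ put $H_T=\{g\in\prod_I G_k : g_k\in B_k\text{ for all }k\notin T\}$. Let $\overline G$ be the direct limit (colimit of groups) of $B=H_\emptyset$, the $H_{\{i\}}$ for $i\in I$, and the $H_{\{i,j\}}$ for edges $\{i,j\}$ of $\Gamma$, along the inclusion maps. Let $N_i$ be the kernel of the action of $G_i$ on $E_i$ and let $N=\prod_I N_i\le B$. Then $\widetilde G=\overline G/N$. Precisely: the canonical map $B\to\overline G$ is injective, the image of $N$ in $\overline G$ (again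 denoted $N$) is normal, there is a chamber of $\widetilde E$ over $C$, and for every chamber $\widetilde C_0\in\widetilde E$ with $p(\widetilde C_0)=C$ there is an isomorphism $\Phi:\overline G/N\to\widetilde G$ such that, for every $T$ that is empty, a single vertex, or an edge of $\Gamma$, and every $x\in H_T$, the image under $\Phi$ of the class of $x$ is a lift of the action of $x$ on $E$ and maps $\widetilde C_0$ into the $T$-residue that contains $\widetilde C_0$. -/

import Mathlib

namespace GraphProd

open Classical in
/-- The right angled Coxeter matrix of a graph: `1` on the diagonal, `2` on edges, and `∞`
(which Mathlib encodes as `0`) on all other pairs. -/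
noncomputable def coxeterMatrix {I : Type*} (Γ : SimpleGraph I) : CoxeterMatrix I where
  M := Matrix.of fun i j => if i = j then 1 else if Γ.Adj i j then 2 else 0
  isSymm := by
    ext i j
    simp only [Matrix.transpose_apply, Matrix.of_apply, eq_comm (a := j) (b := i), Γ.adj_comm j i]
  diagonal i := by simp
  off_diagonal i j h := by
    simp only [Matrix.of_apply, h, if_false]
    split_ifs <;> simp

/-- `T` is spherical if the subgroup `W_T` of the right angled Coxeter group of `Γ` is finite. -/
def IsSpherical {I : Type*} (Γ : SimpleGraph I) (T : Finset I) : Prop :=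
  Finite (Subgroup.closure ((coxeterMatrix Γ).simple '' (T : Set I)))

/-- The poset of spherical subsets of the vertex set, ordered by inclusion. -/
abbrev Spherical {I : Type*} (Γ : SimpleGraph I) : Type _ := {T : Finset I // IsSpherical Γ T}

noncomputable instance {I : Type*} [Fintype I] (Γ : SimpleGraph I) : Fintype (Spherical Γ) :=
  Fintype.ofFinite _

/-- The Davis chamber: the geometric realization of the (finite) poset of spherical subsets,
in barycentric coordinates.  Its simplices are the chains of the poset. -/
def DavisChamber {I : Type*} [Fintype I] (Γ : SimpleGraph I) : Type _ :=
  {x : Spherical Γ → ℝ // x ∈ stdSimplex ℝ (Spherical Γ) ∧ IsChain (· ≤ ·) {T | x T ≠ 0}}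

instance {I : Type*} [Fintype I] (Γ : SimpleGraph I) : TopologicalSpace (DavisChamber Γ) :=
  inferInstanceAs (TopologicalSpace
    {x : Spherical Γ → ℝ // x ∈ stdSimplex ℝ (Spherical Γ) ∧ IsChain (· ≤ ·) {T | x T ≠ 0}})

/-- The `i`-mirror of the Davis chamber: the realization of the poset of those spherical subsets
that contain `i`. -/
def mirror {I : Type*} [Fintype I] (Γ : SimpleGraph I) (i : I) : Set (DavisChamber Γ) :=
  {x | ∀ T : Spherical Γ, x.1 T ≠ 0 → i ∈ T.1}

/-- The gluing relation on `E × K`, where `E = ∏ E_i` carries the discrete topology: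
`(C, x) ∼ (D, y)` iff `x = y` and the distance from `C` to `D` in the product building lies in the
subgroup generated by the `i` with `x` in the `i`-mirror.  The `E_i` being rank one buildings,
the `i`-th component of the distance is trivial exactly when `C i = D i`. -/
def gluing {I : Type*} [Fintype I] (Γ : SimpleGraph I) (E : I → Type*) :
    Setoid (Σ _ : (∀ i, E i), DavisChamber Γ) where
  r a b := a.2 = b.2 ∧ ∀ i, a.2 ∉ mirror Γ i → a.1 i = b.1 i
  iseqv :=
    { refl := fun _ => ⟨rfl, fun _ _ => rfl⟩
      symm := fun h => ⟨h.1.symm, fun i hi => (h.2 i (h.1 ▸ hi)).symm⟩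
      trans := fun h k =>
        ⟨h.1.trans k.1, fun i hi => (h.2 i hi).trans (k.2 i (h.1 ▸ hi))⟩ }

/-- The realization of the product building `E = ∏ E_i` whose chambers are copies of the Davis
chamber of the right angled Coxeter group of `Γ`. -/
def Realization {I : Type*} [Fintype I] (Γ : SimpleGraph I) (E : I → Type*) : Type _ :=
  Quotient (gluing Γ E)

instance {I : Type*} [Fintype I] (Γ : SimpleGraph I) (E : I → Type*) :
    TopologicalSpace (Realization Γ E) :=
  inferInstanceAs (TopologicalSpace (Quotient (gluing Γ E)))

/-- The point of the realization with coordinate `x` in the chamber `C`. -/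
def Realization.mk {I : Type*} [Fintype I] (Γ : SimpleGraph I) (E : I → Type*)
    (C : ∀ i, E i) (x : DavisChamber Γ) : Realization Γ E :=
  Quotient.mk (gluing Γ E) ⟨C, x⟩

/-- For a universal covering `q : X → Realization Γ E`, this is the set of chambers of the graph
product of the `E_i` over `Γ`: the copies of the Davis chamber in `X`, given by their
parametrizations.  `base` is the image of the chamber under the projection to `E`; it is determined
by `map`. -/
structure Chamber {I : Type*} [Fintype I] {Γ : SimpleGraph I} {E : I → Type*}
    {X : Type*} [TopologicalSpace X] (q : X → Realization Γ E) where
  base : ∀ i, E i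
  map : C(DavisChamber Γ, X)
  lifts : ∀ x, q (map x) = Realization.mk Γ E base x

/-- Two chambers are `i`-equivalent (`i`-adjacent or equal) if they share their `i`-mirror.
The classes of this relation are the `i`-panels. -/
def PanelEquiv {I : Type*} [Fintype I] {Γ : SimpleGraph I} {E : I → Type*}
    {X : Type*} [TopologicalSpace X] {q : X → Realization Γ E} (i : I) (D D' : Chamber q) : Prop :=
  ∀ x ∈ mirror Γ i, D.map x = D'.map x

/-- `D` and `D'` lie in the same `T`-residue: they are joined by a gallery of type `T`. -/
def SameResidue {I : Type*} [Fintype I] {Γ : SimpleGraph I} {E : I → Type*}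
    {X : Type*} [TopologicalSpace X] {q : X → Realization Γ E} (T : Finset I)
    (D D' : Chamber q) : Prop :=
  Relation.ReflTransGen (fun A B => ∃ i ∈ T, PanelEquiv i A B) D D'

/-- The permutation `φ` of the chambers of the graph product lifts the action of `g ∈ ∏ G_i`
on `E`. -/
def IsLift {I : Type*} [Fintype I] {Γ : SimpleGraph I} {E : I → Type*} {G : I → Type*}
    [∀ i, Group (G i)] [∀ i, MulAction (G i) (E i)]
    {X : Type*} [TopologicalSpace X] {q : X → Realization Γ E}
    (g : ∀ i, G i) (φ : Equiv.Perm (Chamber q)) : Prop :=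
  ∀ (D : Chamber q) (i : I), (φ D).base i = g i • D.base i

/-- The group of all (type preserving) automorphisms of the graph product of the `E_i` over `Γ`. -/
def buildingAut {I : Type*} [Fintype I] {Γ : SimpleGraph I} {E : I → Type*}
    {X : Type*} [TopologicalSpace X] (q : X → Realization Γ E) :
    Subgroup (Equiv.Perm (Chamber q)) where
  carrier := {φ | ∀ (i : I) (D D' : Chamber q), PanelEquiv i (φ D) (φ D') ↔ PanelEquiv i D D'}
  one_mem' := fun _ _ _ => Iff.rfl
  mul_mem' := fun {φ ψ} hφ hψ i D D' => (hφ i (ψ D) (ψ D')).trans (hψ i D D')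
  inv_mem' := fun {φ} hφ i D D' => by
    have h := hφ i (φ⁻¹ D) (φ⁻¹ D')
    rw [show φ (φ⁻¹ D) = D from φ.apply_symm_apply D,
      show φ (φ⁻¹ D') = D' from φ.apply_symm_apply D'] at h
    exact h.symm

/-- The group of all lifts to the graph product of the action of `∏ G_i` on `E`: the
automorphisms that lift the action of some `g ∈ ∏ G_i`. -/
def liftGroup {I : Type*} [Fintype I] {Γ : SimpleGraph I} {E : I → Type*} (G : I → Type*)
    [∀ i, Group (G i)] [∀ i, MulAction (G i) (E i)]
    {X : Type*} [TopologicalSpace X] (q : X → Realization Γ E) :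
    Subgroup (Equiv.Perm (Chamber q)) where
  carrier := {φ | φ ∈ buildingAut q ∧ ∃ g : ∀ i, G i, IsLift g φ}
  one_mem' := ⟨one_mem _, 1, fun D i => by simp⟩
  mul_mem' := by
    rintro φ ψ ⟨hφ, g, hg⟩ ⟨hψ, k, hk⟩
    exact ⟨mul_mem hφ hψ, g * k, fun D i => by
      rw [Equiv.Perm.mul_apply, hg, hk, Pi.mul_apply, mul_smul]⟩
  inv_mem' := by
    rintro φ ⟨hφ, g, hg⟩
    exact ⟨inv_mem hφ, g⁻¹, fun D i => by
      have h := hg (φ⁻¹ D) i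
      rw [show φ (φ⁻¹ D) = D from φ.apply_symm_apply D] at h
      rw [h, Pi.inv_apply, inv_smul_smul]⟩

/-- The index set of the diagram that defines the generalized graph product: the empty set, the
vertices `{i}` and the edges `{i, j}` of `Γ`. -/
abbrev DiagramIndex {I : Type*} (Γ : SimpleGraph I) : Type _ :=
  {T : Finset I // Γ.IsClique (T : Set I) ∧ T.card ≤ 2}

/-- The product with factor `G_k` for `k ∈ T` and `B_k = Stab (C k)` for `k ∉ T`.  For `T = ∅`,
`{i}`, `{i, j}` these are the groups `B`, `H_i`, `H_{i,j}`. -/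
def stab {I : Type*} {E : I → Type*} (G : I → Type*)
    [∀ i, Group (G i)] [∀ i, MulAction (G i) (E i)] (C : ∀ i, E i) (T : Finset I) :
    Subgroup (∀ i, G i) where
  carrier := {g | ∀ k, k ∉ T → g k ∈ MulAction.stabilizer (G k) (C k)}
  one_mem' := fun _ _ => one_mem _
  mul_mem' := fun hg hh k hk => mul_mem (hg k hk) (hh k hk)
  inv_mem' := fun hg k hk => inv_mem (hg k hk)

theorem stab_mono {I : Type*} {E : I → Type*} (G : I → Type*)
    [∀ i, Group (G i)] [∀ i, MulAction (G i) (E i)] (C : ∀ i, E i) {T T' : Finset I}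
    (h : T ≤ T') : stab G C T ≤ stab G C T' :=
  fun _ hg k hk => hg k (fun hT => hk (h hT))

/-- The free product of the groups of the diagram. -/
abbrev DiagramCoprod {I : Type*} (Γ : SimpleGraph I) {E : I → Type*} (G : I → Type*)
    [∀ i, Group (G i)] [∀ i, MulAction (G i) (E i)] (C : ∀ i, E i) : Type _ :=
  Monoid.CoprodI (fun T : DiagramIndex Γ => stab G C T.1)

/-- The normal subgroup that identifies each element with its images under the inclusion maps of
the diagram. -/
def diagramRelations {I : Type*} (Γ : SimpleGraph I) {E : I → Type*} (G : I → Type*)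
    [∀ i, Group (G i)] [∀ i, MulAction (G i) (E i)] (C : ∀ i, E i) :
    Subgroup (DiagramCoprod Γ G C) :=
  Subgroup.normalClosure {z | ∃ (T T' : DiagramIndex Γ) (h : T.1 ≤ T'.1) (x : stab G C T.1),
    z = Monoid.CoprodI.of (M := fun T : DiagramIndex Γ => stab G C T.1) (i := T')
          (Subgroup.inclusion (stab_mono G C h) x) *
        (Monoid.CoprodI.of (M := fun T : DiagramIndex Γ => stab G C T.1) (i := T) x)⁻¹}

instance {I : Type*} (Γ : SimpleGraph I) {E : I → Type*} (G : I → Type*)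
    [∀ i, Group (G i)] [∀ i, MulAction (G i) (E i)] (C : ∀ i, E i) :
    (diagramRelations Γ G C).Normal :=
  Subgroup.normalClosure_normal

/-- The generalized graph product of the `G_i` over `Γ`: the direct limit (colimit in groups) of
`B`, the `H_i` and the `H_{i,j}` along the inclusions. -/
abbrev GenGraphProduct {I : Type*} (Γ : SimpleGraph I) {E : I → Type*} (G : I → Type*)
    [∀ i, Group (G i)] [∀ i, MulAction (G i) (E i)] (C : ∀ i, E i) : Type _ :=
  DiagramCoprod Γ G C ⧸ diagramRelations Γ G C

/-- The canonical maps of `B`, `H_i`, `H_{i,j}` into the generalized graph product. -/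
def GenGraphProduct.of {I : Type*} (Γ : SimpleGraph I) {E : I → Type*} (G : I → Type*)
    [∀ i, Group (G i)] [∀ i, MulAction (G i) (E i)] (C : ∀ i, E i) (T : DiagramIndex Γ) :
    stab G C T.1 →* GenGraphProduct Γ G C :=
  (QuotientGroup.mk' (diagramRelations Γ G C)).comp
    (Monoid.CoprodI.of (M := fun T : DiagramIndex Γ => stab G C T.1) (i := T))

/-- The empty set as an index of the diagram; its group is `B`. -/
def emptyIndex {I : Type*} (Γ : SimpleGraph I) : DiagramIndex Γ := ⟨∅, by simp, by simp⟩

/-- `N = ∏ N_i` as a subgroup of `B`, where `N_i` is the kernel of the action of `G_i` on `E_i`. -/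
def kernelInB {I : Type*} (Γ : SimpleGraph I) {E : I → Type*} (G : I → Type*)
    [∀ i, Group (G i)] [∀ i, MulAction (G i) (E i)] (C : ∀ i, E i) :
    Subgroup (stab G C (emptyIndex Γ).1) :=
  (Subgroup.pi Set.univ fun i => (MulAction.toPermHom (G i) (E i)).ker).subgroupOf _

/-- `N` as a subgroup of the generalized graph product, through `B`. -/
def kernel {I : Type*} (Γ : SimpleGraph I) {E : I → Type*} (G : I → Type*)
    [∀ i, Group (G i)] [∀ i, MulAction (G i) (E i)] (C : ∀ i, E i) :
    Subgroup (GenGraphProduct Γ G C) :=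
  (kernelInB Γ G C).map (GenGraphProduct.of Γ G C (emptyIndex Γ))

end GraphProd

/-! Write Ḡ for the generalized graph product and `proj` for its canonical map to ∏ G_i. For T ⊆ I,
let the parabolic subgroup of T be the subgroup of Ḡ generated by B and the G_i with i ∈ T. Glue
copies gK of the Davis chamber, indexed by g ∈ Ḡ, so that gK and hK share the point x exactly when
g⁻¹h lies in the parabolic subgroup of the mirrors through x. The resulting `CosetSpace` maps to the
realization of E by sending gK to the chamber proj(g)C.

The mirrors through a point of K form a clique, and over a clique the relations of the diagram are
strong enough that `proj` embeds the parabolic subgroup (`eq_one_of_mem_parabolic`). Hence the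
kernel of `proj` acts properly discontinuously, and the map to the realization is a covering
(`isQuotientCoveringMap_toRealization`). The coset space is path connected because B and the G_i
generate Ḡ.

Its simple connectivity is never proved directly. Instead a morphism of coverings to X is built.
Mark each chamber of X by an element of ∏ G_i that carries C to its projection. Then x ∈ H_T acts
from the right: it multiplies the marking by x and passes to the chamber that shares the vertex T of
K. These moves satisfy the relations of the diagram (`move_inclusion`), so Ḡ acts on the marked
chambers, and the orbit of a chamber over C yields a map from the coset space to X. A morphism from
a path connected covering to a simply connected one is bijective (`bijective_of_comp_eq`), so the
chambers of X are the cosets of B in Ḡ.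

Left multiplication now gives the homomorphism to the group of lifts. It is onto because a lift of
the identity that fixes one chamber is trivial (`eq_one_of_isLift_one`), and its kernel is N
(`ker_toLiftGroup`). -/

namespace IsCoveringMap

/-! ### Morphisms of covering spaces -/

variable {A B X : Type*} [TopologicalSpace A] [TopologicalSpace B] [TopologicalSpace X]

/-- A morphism from a path connected covering space to a simply connected one is bijective. -/
theorem bijective_of_comp_eq [PathConnectedSpace A] [SimplyConnectedSpace X] {r : A → B}
    {q : X → B} {θ : A → X} (hr : IsCoveringMap r) (hq : IsCoveringMap q) (hθ : Continuous θ)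
    (h : ∀ a, q (θ a) = r a) : Function.Bijective θ := by
  constructor
  -- A path from a to a' becomes a loop in X, which is null-homotopic. Its image in B is then
  -- null-homotopic too, so the lift from a is closed, and a' = a.
  · intro a a' haa
    let δ : Path a a' := PathConnectedSpace.somePath a a'
    let θδ : Path (θ a) (θ a) := (δ.map hθ).cast rfl haa
    obtain ⟨F⟩ := (SimplyConnectedSpace.paths_homotopic θδ (Path.refl _)).map ⟨q, hq.continuous⟩
    have h₀ : (θδ.map hq.continuous).toContinuousMap 0 = r a := by simpa using h a
    have h₁ : ((Path.refl (θ a)).map hq.continuous).toContinuousMap 0 = r a := by simpa using h a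
    have key := hr.liftPath_apply_one_eq_of_homotopicRel ⟨F⟩ a h₀ h₁
    have h1 : δ.toContinuousMap = hr.liftPath _ a h₀ :=
      (hr.eq_liftPath_iff' (γ := (θδ.map hq.continuous).toContinuousMap) h₀).2
        ⟨by ext t; simp [θδ, h], δ.source⟩
    have h2 : ContinuousMap.const unitInterval a = hr.liftPath _ a h₁ :=
      (hr.eq_liftPath_iff' (γ := ((Path.refl (θ a)).map hq.continuous).toContinuousMap)
        h₁).2 ⟨by ext t; simp [h], rfl⟩
    have h1' := congrArg (fun f : C(unitInterval, A) => f 1) h1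
    have h2' := congrArg (fun f : C(unitInterval, A) => f 1) h2
    have h3 : δ.toContinuousMap 1 = a' := δ.target
    exact (h2'.trans (key.symm.trans (h1'.symm.trans h3)))
  · intro z
    -- Push a path from θ a to z down to B and lift it to A. By uniqueness of lifts to X, θ maps the
    -- new path onto the old one.
    obtain ⟨a⟩ := (inferInstance : Nonempty A)
    let γ : Path (θ a) z := PathConnectedSpace.somePath _ _
    obtain ⟨Γ, hΓ, h0⟩ := hr.exists_path_lifts (γ.map hq.continuous).toContinuousMap a
      (by simpa using h a)
    have : θ ∘ Γ = γ := hq.eq_of_comp_eq (hθ.comp Γ.continuous) γ.continuous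
      (by ext t; simpa [h] using congrFun hΓ t) 0 (by simp [h0])
    exact ⟨Γ 1, by simpa using congrFun this 1⟩

end IsCoveringMap

namespace GraphProd

/-! ### Spherical subsets are the cliques -/

section spherical

variable {I : Type*} (Γ : SimpleGraph I)

theorem isSpherical_empty : IsSpherical Γ ∅ := by
  unfold IsSpherical
  rw [Finset.coe_empty, Set.image_empty, Subgroup.closure_empty]
  infer_instance

-- The generators in a clique are commuting involutions, so the subgroup they generate is abelian,
-- finitely generated and torsion.
open Classical IsMulCommutative in
theorem isSpherical_of_isClique {T : Finset I} (hT : Γ.IsClique (T : Set I)) :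
    IsSpherical Γ T := by
  unfold IsSpherical
  let cs := (coxeterMatrix Γ).toCoxeterSystem
  set s : I → (coxeterMatrix Γ).Group := (coxeterMatrix Γ).simple with hs
  have hsq (i : I) : s i * s i = 1 := cs.simple_mul_simple_self i
  have hcomm : ∀ x ∈ s '' (T : Set I), ∀ y ∈ s '' (T : Set I), x * y = y * x := by
    rintro _ ⟨i, hi, rfl⟩ _ ⟨j, hj, rfl⟩
    by_cases hij : i = j
    · rw [hij]
    have h2 : (coxeterMatrix Γ).M i j = 2 := by
      simp [coxeterMatrix, hij, hT hi hj hij]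
    have h := cs.simple_mul_simple_pow i j
    rw [h2, pow_two] at h
    have h' : (s i * s j) * (s i * s j) = 1 := h
    calc s i * s j = (s i * s j)⁻¹ := eq_inv_of_mul_eq_one_left h'
      _ = s j * s i := by
        rw [mul_inv_rev, inv_eq_of_mul_eq_one_left (hsq i), inv_eq_of_mul_eq_one_left (hsq j)]
  have := Subgroup.isMulCommutative_closure hcomm
  have : Group.FG (Subgroup.closure (s '' (T : Set I))) :=
    (Group.fg_iff_subgroup_fg _).2 ⟨T.image s, by simp⟩
  refine CommGroup.finite_of_fg_isMulTorsion _ ?_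
  have : ∀ x ∈ Subgroup.closure (s '' (T : Set I)), x * x = 1 := by
    intro x hx
    induction hx using Subgroup.closure_induction with
    | mem x hx => obtain ⟨i, -, rfl⟩ := hx; exact hsq i
    | one => simp
    | mul x y hx hy h1 h2 =>
      have hxy : x * y = y * x := congrArg Subtype.val
        (mul_comm (⟨x, hx⟩ : Subgroup.closure (s '' (T : Set I))) ⟨y, hy⟩)
      calc x * y * (x * y) = x * (y * x) * y := by group
        _ = (x * x) * (y * y) := by rw [← hxy]; group
        _ = 1 := by rw [h1, h2, one_mul]
    | inv x hx h => rw [← mul_inv_rev, h, inv_one]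
  intro x
  exact isOfFinOrder_iff_pow_eq_one.2 ⟨2, by norm_num, Subtype.ext (by
    rw [pow_two]; exact this x.1 x.2)⟩

-- Two distinct non-adjacent generators would map to the standard reflections of the infinite
-- dihedral group `DihedralGroup 0`, where their product is a translation of infinite order.
open Classical in
theorem IsSpherical.isClique {T : Finset I} (hT : IsSpherical Γ T) :
    Γ.IsClique (T : Set I) := by
  intro i hi j hj hij
  by_contra hadj
  let cs := (coxeterMatrix Γ).toCoxeterSystem
  let f : I → DihedralGroup 0 := fun k =>
    if k = i then .sr 0 else if k = j then .sr 1 else 1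
  have hf2 (k : I) : f k * f k = 1 := by
    simp only [f]
    split_ifs <;> simp [DihedralGroup.sr_mul_sr]
  have hf : (coxeterMatrix Γ).IsLiftable f := by
    intro a b
    by_cases hab : a = b
    · subst hab; rw [hf2, one_pow]
    by_cases hG : Γ.Adj a b
    · have h2 : (coxeterMatrix Γ).M a b = 2 := by simp [coxeterMatrix, hab, hG]
      rw [h2, pow_two]
      -- Only i and j have non-trivial images, and they are not adjacent.
      have : f a = 1 ∨ f b = 1 := by
        by_contra! h
        have ha : a = i ∨ a = j := by
          by_contra! h'
          exact h.1 (by simp [f, h'.1, h'.2])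
        have hb : b = i ∨ b = j := by
          by_contra! h'
          exact h.2 (by simp [f, h'.1, h'.2])
        rcases ha with rfl | rfl <;> rcases hb with rfl | rfl
        · exact hab rfl
        · exact hadj hG
        · exact hadj hG.symm
        · exact hab rfl
      rcases this with h | h
      · rw [h, one_mul, hf2]
      · rw [h, mul_one, hf2]
    · have h0 : (coxeterMatrix Γ).M a b = 0 := by simp [coxeterMatrix, hab, hG]
      rw [h0, pow_zero]
  let φ := cs.lift ⟨f, hf⟩
  have hφ (k : I) : φ ((coxeterMatrix Γ).simple k) = f k := cs.lift_apply_simple hf k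
  let w : Subgroup.closure ((coxeterMatrix Γ).simple '' (T : Set I)) :=
    ⟨(coxeterMatrix Γ).simple i * (coxeterMatrix Γ).simple j,
      mul_mem (Subgroup.subset_closure ⟨i, hi, rfl⟩) (Subgroup.subset_closure ⟨j, hj, rfl⟩)⟩
  have : Finite (Subgroup.closure ((coxeterMatrix Γ).simple '' (T : Set I))) := hT
  obtain ⟨n, hn, hw⟩ := isOfFinOrder_iff_pow_eq_one.1 (isOfFinOrder_of_finite w)
  have h1 := congrArg (fun v => φ (Subtype.val v)) hw
  have hprod : φ w.1 = DihedralGroup.r 1 := by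
    simp only [w, map_mul, hφ]
    simp [f, hij.symm, DihedralGroup.sr_mul_sr]
  simp only [SubmonoidClass.coe_pow, map_pow, hprod, OneMemClass.coe_one, map_one,
    DihedralGroup.r_one_pow, DihedralGroup.one_def, DihedralGroup.r.injEq] at h1
  have h3 : (n : ℤ) = 0 := by exact_mod_cast h1
  omega

end spherical

/-! ### Topology of the Davis chamber and lifts of chambers -/

section chamber

variable {I : Type*} [Fintype I] {Γ : SimpleGraph I}

open Classical in
/-- The vertex of the Davis chamber that corresponds to the spherical subset `T`. -/
noncomputable def vertex (T : Spherical Γ) : DavisChamber Γ :=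
  ⟨Pi.single T 1, single_mem_stdSimplex ℝ T, fun U hU V hV _ => by
    have h1 : U = T := by by_contra h; exact hU (Pi.single_eq_of_ne h _)
    have h2 : V = T := by by_contra h; exact hV (Pi.single_eq_of_ne h _)
    exact Or.inl (h1.trans h2.symm).le⟩

/-- The intersection of the `i`-mirrors for `i ∈ T`. -/
def coface (T : Spherical Γ) : Set (DavisChamber Γ) := {x | ∀ U, x.1 U ≠ 0 → T ≤ U}

theorem mem_coface_iff {T : Spherical Γ} {x : DavisChamber Γ} :
    x ∈ coface T ↔ ∀ i ∈ T.1, x ∈ mirror Γ i :=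
  ⟨fun h _ hi U hU => h U hU hi, fun h U hU i hi => h i hi U hU⟩

theorem vertex_apply_ne {T U : Spherical Γ} (h : (vertex T).1 U ≠ 0) : U = T := by
  classical
  by_contra h'
  exact h (Pi.single_eq_of_ne h' _)

theorem vertex_mem_coface {T T' : Spherical Γ} (h : T ≤ T') : vertex T' ∈ coface T :=
  fun _ hU => (vertex_apply_ne hU).symm ▸ h

/-- The cone structure on a coface: the segment from the vertex `T` to a point. -/
noncomputable def cone (T : Spherical Γ) (p : unitInterval × coface T) : DavisChamber Γ :=
  ⟨fun U => (1 - (p.1 : ℝ)) * (vertex T).1 U + p.1 * p.2.1.1 U,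
    by
      have := convex_stdSimplex ℝ (Spherical Γ) (vertex T).2.1 p.2.1.2.1
        (sub_nonneg.2 p.1.2.2) p.1.2.1 (sub_add_cancel _ _)
      exact this,
    by
      intro U hU V hV hne
      have key : ∀ U, (1 - (p.1 : ℝ)) * (vertex T).1 U + p.1 * p.2.1.1 U ≠ 0 →
          U = T ∨ p.2.1.1 U ≠ 0 := by
        intro U hU
        by_contra! h
        refine hU ?_
        rw [h.2, mul_zero, add_zero]
        by_contra h'
        exact h.1 (vertex_apply_ne (right_ne_zero_of_mul h'))
      rcases key U hU with rfl | h1 <;> rcases key V hV with rfl | h2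
      · exact absurd rfl hne
      · exact Or.inl (p.2.2 V h2)
      · exact Or.inr (p.2.2 U h1)
      · exact p.2.1.2.2 h1 h2 hne⟩

theorem continuous_coordinate (U : Spherical Γ) :
    Continuous fun x : DavisChamber Γ => x.1 U :=
  (continuous_apply U).comp (continuous_subtype_val
    (p := fun x => x ∈ stdSimplex ℝ (Spherical Γ) ∧ IsChain (· ≤ ·) {T | x T ≠ 0}))

theorem continuous_cone (T : Spherical Γ) : Continuous (cone T) := by
  refine Continuous.subtype_mk (continuous_pi fun U => ?_) _
  have h : Continuous fun p : unitInterval × coface T => p.2.1.1 U :=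
    (continuous_coordinate U).comp (continuous_subtype_val.comp continuous_snd)
  have h' : Continuous fun p : unitInterval × coface T => (p.1 : ℝ) :=
    continuous_subtype_val.comp continuous_fst
  exact ((continuous_const.sub h').mul continuous_const).add (h'.mul h)

theorem cone_zero (T : Spherical Γ) (x : coface T) : cone T (0, x) = vertex T :=
  Subtype.ext (funext fun U => by simp [cone])

theorem cone_one (T : Spherical Γ) (x : coface T) : cone T (1, x) = x :=
  Subtype.ext (funext fun U => by simp [cone])

theorem cone_mem (T : Spherical Γ) (p : unitInterval × coface T) : cone T p ∈ coface T := by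
  intro U hU
  by_contra h
  have h1 : (vertex T).1 U = 0 := by
    by_contra h'
    exact h (vertex_apply_ne h').ge
  have h2 : p.2.1.1 U = 0 := by
    by_contra h'
    exact h (p.2.2 U h')
  exact hU (by simp [cone, h1, h2])

/-- The coface is a cone with apex the vertex T. -/
theorem isPreconnected_coface (T : Spherical Γ) : IsPreconnected (coface T) := by
  refine isPreconnected_of_forall (vertex T) fun y hy => ?_
  refine ⟨Set.range fun t : unitInterval => cone T (t, ⟨y, hy⟩), ?_, ⟨0, cone_zero T _⟩,
    ⟨1, cone_one T _⟩,
    isPreconnected_range ((continuous_cone T).comp (Continuous.prodMk_left _))⟩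
  rintro _ ⟨t, rfl⟩
  exact cone_mem T _

open Classical in
/-- The set of `i` such that `x` lies in the `i`-mirror. -/
noncomputable def mirrors (x : DavisChamber Γ) : Finset I := Finset.univ.filter (x ∈ mirror Γ ·)

@[simp] theorem mem_mirrors {x : DavisChamber Γ} {i : I} : i ∈ mirrors x ↔ x ∈ mirror Γ i := by
  simp [mirrors]

/-- All mirrors through x are indexed by elements of any spherical set in the support of x. -/
theorem isClique_mirrors (x : DavisChamber Γ) : Γ.IsClique (mirrors x : Set I) := by
  have : ∃ U, x.1 U ≠ 0 := by
    by_contra! h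
    have := x.2.1.2
    simp [h] at this
  obtain ⟨U, hU⟩ := this
  refine (IsSpherical.isClique Γ U.2).subset fun i hi => ?_
  exact (mem_mirrors.1 hi) U hU

theorem isClosed_mirror (i : I) : IsClosed (mirror Γ i) := by
  have : mirror Γ i = ⋂ (U : Spherical Γ) (_ : i ∉ U.1), {x | x.1 U = 0} := by
    ext x
    simp only [mirror, Set.mem_ofPred_eq, Set.mem_iInter]
    exact forall_congr' fun U => not_imp_comm
  rw [this]
  exact isClosed_iInter fun U => isClosed_iInter fun _ =>
    isClosed_eq (continuous_coordinate U) continuous_const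

theorem isOpen_mirrors_subset (T : Finset I) : IsOpen {x : DavisChamber Γ | mirrors x ⊆ T} := by
  have : {x : DavisChamber Γ | mirrors x ⊆ T} = ⋂ (i : I) (_ : i ∉ T), (mirror Γ i)ᶜ := by
    ext x
    simp only [Set.mem_ofPred_eq, Set.mem_iInter, Set.mem_compl_iff]
    exact forall_congr' fun i => by rw [mem_mirrors, not_imp_not]
  rw [this]
  exact isOpen_iInter_of_finite fun i => isOpen_iInter_of_finite fun _ =>
    (isClosed_mirror i).isOpen_compl

/-- The empty spherical subset. -/
def sphericalEmpty (Γ : SimpleGraph I) : Spherical Γ := ⟨∅, isSpherical_empty Γ⟩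

theorem mem_coface_sphericalEmpty (x : DavisChamber Γ) : x ∈ coface (sphericalEmpty Γ) :=
  fun _ _ => Finset.empty_subset _

/-- An element of the diagram index as a spherical subset. -/
def DiagramIndex.spherical (T : DiagramIndex Γ) : Spherical Γ :=
  ⟨T.1, isSpherical_of_isClique Γ T.2.1⟩

variable {E : I → Type*}

theorem Realization.mk_eq_mk_iff {D D' : ∀ i, E i} {x x' : DavisChamber Γ} :
    Realization.mk Γ E D x = Realization.mk Γ E D' x' ↔
      x = x' ∧ ∀ i, x ∉ mirror Γ i → D i = D' i :=
  Quotient.eq (r := gluing Γ E)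

variable {X : Type*} [TopologicalSpace X] {q : X → Realization Γ E}

theorem Realization.continuous_mk (D : ∀ i, E i) : Continuous (Realization.mk Γ E D) :=
  continuous_quot_mk.comp (continuous_sigmaMk (σ := fun _ : (∀ i, E i) => DavisChamber Γ) (i := D))

/-- On the coface of T the realization forgets the coordinates in T. Both maps therefore lift the
same map on a connected set, and agreement at one point spreads. -/
theorem Chamber.eqOn_coface (hq : IsCoveringMap q) (T : Spherical Γ) {D D' : Chamber q}
    (h : ∀ i ∉ T.1, D.base i = D'.base i) {x : DavisChamber Γ} (hx : x ∈ coface T)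
    (hDx : D.map x = D'.map x) : Set.EqOn D.map D'.map (coface T) :=
  hq.eqOn_of_comp_eqOn (isPreconnected_coface T) D.map.continuous.continuousOn
    D'.map.continuous.continuousOn
    (fun y hy => by
      simp only [Function.comp, D.lifts, D'.lifts, Realization.mk_eq_mk_iff, true_and]
      intro i hi
      exact h i fun hiT => hi (mem_coface_iff.1 hy i hiT)) hx hDx

theorem Chamber.ext_of_apply_eq (hq : IsCoveringMap q) {D D' : Chamber q}
    (h : D.base = D'.base) {x : DavisChamber Γ} (hDx : D.map x = D'.map x) : D = D' := by
  have := Chamber.eqOn_coface hq (sphericalEmpty Γ) (fun i _ => congrFun h i)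
    (mem_coface_sphericalEmpty x) hDx
  have hmap : D.map = D'.map := ContinuousMap.ext fun y => this (mem_coface_sphericalEmpty y)
  cases D; cases D'
  cases h; cases hmap; rfl

/-- The cone structure contracts K to the vertex ∅. Lifting the segment from x to this apex gives a
point over the apex. From there the lifted contraction, run backwards, sweeps out the chamber. -/
theorem Chamber.exists_of_apply_eq (hq : IsCoveringMap q) (D : ∀ i, E i) (x : DavisChamber Γ)
    (z : X) (hz : q z = Realization.mk Γ E D x) : ∃ D' : Chamber q, D'.base = D ∧ D'.map x = z := by
  let e (y : DavisChamber Γ) : coface (sphericalEmpty Γ) := ⟨y, mem_coface_sphericalEmpty y⟩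
  have he : Continuous e := continuous_id.subtype_mk _
  let c : C(unitInterval × DavisChamber Γ, Realization Γ E) :=
    ⟨fun p => Realization.mk Γ E D (cone (sphericalEmpty Γ) (p.1, e p.2)),
      (Realization.continuous_mk D).comp ((continuous_cone _).comp
        (continuous_fst.prodMk (he.comp continuous_snd)))⟩
  have hσ : Continuous fun t : unitInterval => c (unitInterval.symm t, x) :=
    c.continuous.comp ((unitInterval.continuous_symm).prodMk continuous_const)
  obtain ⟨α, hα, hα0⟩ := hq.exists_path_lifts ⟨_, hσ⟩ z
    (by simp [c, cone_one, hz, e])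
  have h0 (a : DavisChamber Γ) : c (0, a) = q (ContinuousMap.const (DavisChamber Γ) (α 1) a) := by
    have := congrFun hα 1
    simp only [Function.comp, ContinuousMap.coe_mk, unitInterval.symm_one] at this
    rw [ContinuousMap.const_apply, this]
    simp [c, cone_zero]
  let H := hq.liftHomotopy c (ContinuousMap.const _ (α 1)) h0
  have hH : ∀ p, q (H p) = c p := congrFun (hq.liftHomotopy_lifts c _ h0)
  refine ⟨⟨D, H.comp ⟨fun y => (1, y), by fun_prop⟩, fun y => ?_⟩, rfl, ?_⟩
  · simp [hH, c, cone_one, e]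
  -- The lifted contraction along the segment of x and the path α lift the same path and agree over
  -- the apex, hence also over x.
  · have h1 : Continuous fun t : unitInterval => H (unitInterval.symm t, x) :=
      H.continuous.comp ((unitInterval.continuous_symm).prodMk continuous_const)
    have := hq.eq_of_comp_eq h1 α.continuous
      (by rw [hα]; ext t; simp [hH]) 1 (by
        simp only [unitInterval.symm_one]
        exact hq.liftHomotopy_zero c _ h0 x)
    have h2 := congrFun this 0
    simpa [hα0] using h2

end chamber

end GraphProd

namespace GraphProd

/-! ### Parabolic subgroups of the generalized graph product -/

section group

variable {I : Type*} (Γ : SimpleGraph I) {E : I → Type*} (G : I → Type*)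
  [∀ i, Group (G i)] [∀ i, MulAction (G i) (E i)] (C : ∀ i, E i)

theorem mem_stab {T : Finset I} {g : ∀ i, G i} :
    g ∈ stab G C T ↔ ∀ k ∉ T, g k • C k = C k := Iff.rfl

/-- The vertex `i` as an index of the diagram; its group is `H_{i}`. -/
def vertexIndex (i : I) : DiagramIndex Γ := ⟨{i}, by simp, by simp⟩

namespace GenGraphProduct

variable {Γ} in
theorem of_inclusion {T T' : DiagramIndex Γ} (h : T.1 ≤ T'.1) (x : stab G C T.1) :
    of Γ G C T' (Subgroup.inclusion (stab_mono G C h) x) = of Γ G C T x := by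
  refine (QuotientGroup.eq_iff_div_mem (N := diagramRelations Γ G C)).2 ?_
  rw [div_eq_mul_inv]
  exact Subgroup.subset_normalClosure ⟨T, T', h, x, rfl⟩

/-- The universal property of the generalized graph product. -/
def lift {H : Type*} [Group H] (f : ∀ T : DiagramIndex Γ, stab G C T.1 →* H)
    (hf : ∀ (T T' : DiagramIndex Γ) (h : T.1 ≤ T'.1) (x : stab G C T.1),
      f T' (Subgroup.inclusion (stab_mono G C h) x) = f T x) : GenGraphProduct Γ G C →* H :=
  QuotientGroup.lift (diagramRelations Γ G C) (Monoid.CoprodI.lift f) <| by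
    refine Subgroup.normalClosure_le_normal (N := (Monoid.CoprodI.lift f).ker) ?_
    rintro _ ⟨T, T', h, x, rfl⟩
    rw [SetLike.mem_coe, MonoidHom.mem_ker, map_mul, map_inv, Monoid.CoprodI.lift_of,
      Monoid.CoprodI.lift_of, hf T T' h x, mul_inv_cancel]

@[simp] theorem lift_of {H : Type*} [Group H] (f : ∀ T : DiagramIndex Γ, stab G C T.1 →* H)
    (hf : ∀ (T T' : DiagramIndex Γ) (h : T.1 ≤ T'.1) (x : stab G C T.1),
      f T' (Subgroup.inclusion (stab_mono G C h) x) = f T x) (T : DiagramIndex Γ)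
    (x : stab G C T.1) : lift Γ G C f hf (of Γ G C T x) = f T x :=
  (QuotientGroup.lift_mk ..).trans (Monoid.CoprodI.lift_of ..)

/-- The canonical map of the generalized graph product to the product. -/
def proj : GenGraphProduct Γ G C →* ∀ i, G i :=
  lift Γ G C (fun T => (stab G C T.1).subtype) fun _ _ _ _ => rfl

@[simp] theorem proj_of (T : DiagramIndex Γ) (x : stab G C T.1) :
    proj Γ G C (of Γ G C T x) = x := lift_of ..

/-- The canonical map of `B`. -/
abbrev base : stab G C (emptyIndex Γ).1 →* GenGraphProduct Γ G C := of Γ G C (emptyIndex Γ)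

theorem base_injective : Function.Injective (base Γ G C) := fun x y h =>
  Subtype.ext (by simpa using congrArg (proj Γ G C) h)

open Classical in
theorem mulSingle_mem_stab {T : Finset I} {i : I} (hi : i ∈ T) (a : G i) :
    Pi.mulSingle i a ∈ stab G C T := by
  intro k hk
  rw [Pi.mulSingle_eq_of_ne (by rintro rfl; exact hk hi)]
  exact one_mem _

open Classical in
/-- The canonical map of the factor `G i`. -/
noncomputable def single (i : I) : G i →* GenGraphProduct Γ G C :=
  (of Γ G C (vertexIndex Γ i)).comp <| MonoidHom.mk'
    (fun a => ⟨Pi.mulSingle i a, mulSingle_mem_stab G C (Finset.mem_singleton_self i) a⟩)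
    fun a a' => Subtype.ext (Pi.mulSingle_mul i a a')

open Classical in
@[simp] theorem proj_single (i : I) (a : G i) : proj Γ G C (single Γ G C i a) = Pi.mulSingle i a := by
  simp [single]

open Classical in
theorem of_mulSingle (T : DiagramIndex Γ) {i : I} (hi : i ∈ T.1) (a : G i) :
    of Γ G C T ⟨Pi.mulSingle i a, mulSingle_mem_stab G C hi a⟩ = single Γ G C i a :=
  of_inclusion G C (T := vertexIndex Γ i) (Finset.singleton_subset_iff.2 hi)
    ⟨Pi.mulSingle i a, mulSingle_mem_stab G C (Finset.mem_singleton_self i) a⟩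

theorem base_eq_single {i : I} (b : stab G C (emptyIndex Γ).1) (hb : ∀ k ≠ i, b.1 k = 1) :
    base Γ G C b = single Γ G C i (b.1 i) := by
  classical
  rw [base, ← of_inclusion G C (T' := vertexIndex Γ i) (Finset.empty_subset _)]
  simp only [single, MonoidHom.comp_apply]
  congr 1
  refine Subtype.ext (funext fun k => ?_)
  by_cases hk : k = i
  · subst hk; simp
  · simp [hk, hb k hk]

theorem single_mem_range_base {i : I} {a : G i} (ha : a • C i = C i) :
    single Γ G C i a ∈ (base Γ G C).range := by
  classical
  let b : stab G C (emptyIndex Γ).1 := ⟨Pi.mulSingle i a, by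
    rw [mem_stab]
    intro k _
    by_cases hk : k = i
    · subst hk; simpa using ha
    · simp [hk]⟩
  refine ⟨b, ?_⟩
  rw [base_eq_single Γ G C (i := i) b fun k hk => by simp [b, hk]]
  simp [b]

theorem base_mul_single (b : stab G C (emptyIndex Γ).1) (i : I) (a : G i) :
    base Γ G C b * single Γ G C i a =
      single Γ G C i (b.1 i * a * (b.1 i)⁻¹) * base Γ G C b := by
  classical
  rw [base, ← of_inclusion G C (T' := vertexIndex Γ i) (Finset.empty_subset _)]
  simp only [single, MonoidHom.comp_apply, ← map_mul]
  congr 1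
  refine Subtype.ext (funext fun k => ?_)
  by_cases hk : k = i
  · subst hk; simp
  · simp [hk]

theorem single_mul_single {i j : I} (h : Γ.Adj i j) (a : G i) (a' : G j) :
    single Γ G C i a * single Γ G C j a' = single Γ G C j a' * single Γ G C i a := by
  classical
  let T : DiagramIndex Γ := ⟨{i, j}, by
    simpa [SimpleGraph.isClique_pair] using fun _ => h, Finset.card_le_two⟩
  rw [← of_mulSingle Γ G C T (by simp [T]), ← of_mulSingle Γ G C T (by simp [T]),
    ← map_mul, ← map_mul]
  congr 1
  exact Subtype.ext (Pi.mulSingle_commute h.ne a a')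

/-- The subgroup generated by `B` and the `G i` with `i ∈ T`. -/
def parabolic (T : Finset I) : Subgroup (GenGraphProduct Γ G C) :=
  Subgroup.closure (Set.range (base Γ G C) ∪ ⋃ i ∈ T, Set.range (single Γ G C i))

variable {Γ G C}

theorem base_mem_parabolic (T : Finset I) (b : stab G C (emptyIndex Γ).1) :
    base Γ G C b ∈ parabolic Γ G C T :=
  Subgroup.subset_closure (Or.inl ⟨b, rfl⟩)

theorem single_mem_parabolic {T : Finset I} {i : I} (hi : i ∈ T) (a : G i) :
    single Γ G C i a ∈ parabolic Γ G C T :=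
  Subgroup.subset_closure (Or.inr (Set.mem_biUnion hi ⟨a, rfl⟩))

theorem parabolic_mono {T T' : Finset I} (h : T ⊆ T') :
    parabolic Γ G C T ≤ parabolic Γ G C T' :=
  Subgroup.closure_mono (Set.union_subset_union_right _
    (Set.biUnion_subset_biUnion_left h))

theorem parabolic_induction {T : Finset I}
    {motive : (g : GenGraphProduct Γ G C) → g ∈ parabolic Γ G C T → Prop}
    (base : ∀ b, motive (base Γ G C b) (base_mem_parabolic T b))
    (single : ∀ i, ∀ hi : i ∈ T, ∀ a, motive (single Γ G C i a) (single_mem_parabolic hi a))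
    (mul : ∀ g h hg hh, motive g hg → motive h hh → motive (g * h) (mul_mem hg hh))
    (inv : ∀ g hg, motive g hg → motive g⁻¹ (inv_mem hg))
    {g : GenGraphProduct Γ G C} (hg : g ∈ parabolic Γ G C T) : motive g hg := by
  induction hg using Subgroup.closure_induction with
  | mem x hx =>
    rcases hx with ⟨b, rfl⟩ | hx
    · exact base b
    · obtain ⟨i, hi, a, rfl⟩ := Set.mem_iUnion₂.1 hx
      exact single i hi a
  | one => simpa using base 1
  | mul x y hx hy h1 h2 => exact mul x y hx hy h1 h2
  | inv x hx h => exact inv x hx h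

theorem parabolic_empty : parabolic Γ G C ∅ = (base Γ G C).range := by
  refine le_antisymm (fun g hg => ?_) ?_
  · induction hg using parabolic_induction with
    | base b => exact ⟨b, rfl⟩
    | single i hi a => simp at hi
    | mul g h _ _ hg hh => exact mul_mem hg hh
    | inv g _ hg => exact inv_mem hg
  · rintro _ ⟨b, rfl⟩
    exact base_mem_parabolic _ b

theorem proj_mem_stab {T : Finset I} {g : GenGraphProduct Γ G C} (hg : g ∈ parabolic Γ G C T) :
    proj Γ G C g ∈ stab G C T := by
  classical
  induction hg using parabolic_induction with
  | base b => rw [proj_of]; exact stab_mono G C (Finset.empty_subset _) b.2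
  | single i hi a => rw [proj_single]; exact mulSingle_mem_stab G C hi a
  | mul g h _ _ hg hh => rw [map_mul]; exact mul_mem hg hh
  | inv g _ hg => rw [map_inv]; exact inv_mem hg

open Classical in
theorem eq_mulSingle_mul_update (x : ∀ i, G i) (k : I) :
    x = Pi.mulSingle k (x k) * Function.update x k 1 := by
  funext j
  by_cases h : j = k
  · subst h; simp
  · simp [h]

open Classical in
theorem update_mem_stab {U : Finset I} {k : I} {x : ∀ i, G i} (hx : x ∈ stab G C (insert k U)) :
    Function.update x k 1 ∈ stab G C U := by
  rw [mem_stab] at hx ⊢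
  intro j hj
  by_cases h : j = k
  · subst h; simp
  · rw [Function.update_of_ne h]
    exact hx j (by simp [h, hj])

/-- The element is a product of its coordinates in T and an element of B, and each factor has a
preimage. -/
theorem exists_mem_parabolic {T : Finset I} {x : ∀ i, G i} (hx : x ∈ stab G C T) :
    ∃ g ∈ parabolic Γ G C T, proj Γ G C g = x := by
  classical
  induction T using Finset.induction_on generalizing x with
  | empty => exact ⟨base Γ G C ⟨x, hx⟩, base_mem_parabolic _ _, proj_of ..⟩
  | insert k U _ ih =>
    obtain ⟨g, hg, hgx⟩ := ih (update_mem_stab hx)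
    exact ⟨single Γ G C k (x k) * g, mul_mem (single_mem_parabolic (Finset.mem_insert_self k U) _)
      (parabolic_mono (Finset.subset_insert k U) hg),
      by rw [map_mul, hgx, proj_single, ← eq_mulSingle_mul_update]⟩

theorem of_mem_parabolic_of_subset (T : DiagramIndex Γ) {U : Finset I} (hU : U ⊆ T.1)
    {x : ∀ i, G i} (hx : x ∈ stab G C U) :
    of Γ G C T ⟨x, stab_mono G C hU hx⟩ ∈ parabolic Γ G C U := by
  classical
  induction U using Finset.induction_on generalizing x with
  | empty =>
    have := of_inclusion (Γ := Γ) G C (T := emptyIndex Γ) (T' := T) (Finset.empty_subset _) ⟨x, hx⟩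
    exact this ▸ base_mem_parabolic _ _
  | insert k U _ ih =>
    have hk : k ∈ T.1 := hU (Finset.mem_insert_self k U)
    have hU' : U ⊆ T.1 := (Finset.subset_insert k U).trans hU
    have : (⟨x, stab_mono G C hU hx⟩ : stab G C T.1) =
        ⟨Pi.mulSingle k (x k), mulSingle_mem_stab G C hk _⟩ *
          ⟨Function.update x k 1, stab_mono G C hU' (update_mem_stab hx)⟩ :=
      Subtype.ext (eq_mulSingle_mul_update x k)
    rw [this, map_mul, of_mulSingle Γ G C T hk]
    exact mul_mem (single_mem_parabolic (Finset.mem_insert_self k U) _)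
      (parabolic_mono (Finset.subset_insert k U) (ih hU' (update_mem_stab hx)))

theorem of_mem_parabolic (T : DiagramIndex Γ) (x : stab G C T.1) :
    of Γ G C T x ∈ parabolic Γ G C T.1 :=
  of_mem_parabolic_of_subset T subset_rfl x.2

theorem mem_parabolic_univ [Fintype I] (g : GenGraphProduct Γ G C) :
    g ∈ parabolic Γ G C Finset.univ := by
  obtain ⟨g, rfl⟩ := QuotientGroup.mk_surjective g
  induction g using Monoid.CoprodI.induction_on with
  | one => exact one_mem _
  | of T x => exact parabolic_mono (Finset.subset_univ _) (of_mem_parabolic T x)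
  | mul x y hx hy => exact mul_mem hx hy

theorem proj_surjective [Fintype I] : Function.Surjective (proj Γ G C) := fun x => by
  obtain ⟨g, -, hg⟩ := exists_mem_parabolic (Γ := Γ) (C := C) (T := Finset.univ) (x := x)
    fun k hk => absurd (Finset.mem_univ k) hk
  exact ⟨g, hg⟩

/-- G_k commutes with the neighbouring G_i and is normalized by B, so all factors from G_k can be
collected on the right. -/
theorem exists_eq_mul_single {T : Finset I} {k : I} (hk : k ∉ T) (hT : ∀ i ∈ T, Γ.Adj k i)
    [DecidableEq I] {g : GenGraphProduct Γ G C} (hg : g ∈ parabolic Γ G C (insert k T)) :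
    ∃ h ∈ parabolic Γ G C T, ∃ a, g = h * single Γ G C k a := by
  -- In this form the claim says that the products h · a are stable under right multiplication,
  -- which can be checked on generators.
  suffices H : ∀ h ∈ parabolic Γ G C T, ∀ a, ∃ h' ∈ parabolic Γ G C T, ∃ a',
      h * single Γ G C k a * g = h' * single Γ G C k a' by
    simpa using H 1 (one_mem _) 1
  have hbase (b : stab G C (emptyIndex Γ).1) : ∀ h ∈ parabolic Γ G C T, ∀ a,
      ∃ h' ∈ parabolic Γ G C T, ∃ a',
        h * single Γ G C k a * base Γ G C b = h' * single Γ G C k a' := by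
    intro h hh a
    refine ⟨h * base Γ G C b, mul_mem hh (base_mem_parabolic _ _),
      (b.1 k)⁻¹ * a * b.1 k, ?_⟩
    rw [mul_assoc h (base Γ G C b), base_mul_single, mul_assoc h]
    congr 3
    group
  have hsingle (i : I) (hi : i ∈ insert k T) (c : G i) : ∀ h ∈ parabolic Γ G C T, ∀ a,
      ∃ h' ∈ parabolic Γ G C T, ∃ a',
        h * single Γ G C k a * single Γ G C i c = h' * single Γ G C k a' := by
    intro h hh a
    rcases Finset.mem_insert.1 hi with rfl | hi
    · exact ⟨h, hh, a * c, by rw [map_mul, mul_assoc]⟩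
    · exact ⟨h * single Γ G C i c, mul_mem hh (single_mem_parabolic hi c), a, by
        rw [mul_assoc, mul_assoc, single_mul_single Γ G C (hT i hi)]⟩
  induction hg using Subgroup.closure_induction_right with
  | one => exact fun h hh a => ⟨h, hh, a, mul_one _⟩
  | mul_right x _ y hy ih =>
    intro h hh a
    obtain ⟨h', hh', a', h1⟩ := ih h hh a
    rw [← mul_assoc, h1]
    rcases hy with ⟨b, rfl⟩ | hy
    · exact hbase b h' hh' a'
    · obtain ⟨i, hi, c, rfl⟩ := Set.mem_iUnion₂.1 hy
      exact hsingle i hi c h' hh' a'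
  | mul_inv_cancel x _ y hy ih =>
    intro h hh a
    obtain ⟨h', hh', a', h1⟩ := ih h hh a
    rw [← mul_assoc, h1]
    rcases hy with ⟨b, rfl⟩ | hy
    · rw [← map_inv]
      exact hbase b⁻¹ h' hh' a'
    · obtain ⟨i, hi, c, rfl⟩ := Set.mem_iUnion₂.1 hy
      rw [← map_inv]
      exact hsingle i hi c⁻¹ h' hh' a'

/-- Over a clique the parabolic subgroups embed into the product. -/
theorem mem_parabolic_of_proj_mem_stab {T S : Finset I} (hT : Γ.IsClique (T : Set I))
    {g : GenGraphProduct Γ G C} (hg : g ∈ parabolic Γ G C T) (hgS : proj Γ G C g ∈ stab G C S) :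
    g ∈ parabolic Γ G C S := by
  classical
  induction T using Finset.induction_on generalizing g with
  | empty => exact parabolic_mono (Finset.empty_subset _) hg
  | insert k T hk ih =>
    have hadj : ∀ i ∈ T, Γ.Adj k i := fun i hi => hT (by simp) (by simp [hi])
      (by rintro rfl; exact hk hi)
    have hT' : Γ.IsClique (T : Set I) := hT.subset (by simp)
    obtain ⟨h, hh, a, rfl⟩ := exists_eq_mul_single hk hadj hg
    -- If k ∉ S, then the k-th coordinates of the product and of h both fix C k, since k ∉ T. So a
    -- fixes C k, and its image lies in B.
    have ha : single Γ G C k a ∈ parabolic Γ G C S := by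
      by_cases hkS : k ∈ S
      · exact single_mem_parabolic hkS a
      · have h1 := hgS k hkS
        have h2 := proj_mem_stab hh k hk
        rw [map_mul, proj_single, Pi.mul_apply, Pi.mulSingle_eq_same] at h1
        have h3 := (Subgroup.mul_mem_cancel_left _ h2).1 h1
        have := single_mem_range_base Γ G C (i := k) (a := a) h3
        rw [← parabolic_empty] at this
        exact parabolic_mono (Finset.empty_subset _) this
    refine mul_mem (ih hT' hh ?_) ha
    rw [map_mul] at hgS
    exact (Subgroup.mul_mem_cancel_right _ (proj_mem_stab ha)).1 hgS

/-- With S = ∅ the element is reduced to B, on which `proj` is injective. This is what makes the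
action of the kernel of `proj` properly discontinuous. -/
theorem eq_one_of_mem_parabolic {T : Finset I} (hT : Γ.IsClique (T : Set I))
    {g : GenGraphProduct Γ G C} (hg : g ∈ parabolic Γ G C T) (h1 : proj Γ G C g = 1) : g = 1 := by
  have h := mem_parabolic_of_proj_mem_stab (S := ∅) hT hg (h1 ▸ one_mem _)
  rw [parabolic_empty] at h
  obtain ⟨b, rfl⟩ := h
  have : b = 1 := Subtype.ext (by simpa using h1)
  rw [this, map_one]

theorem mem_kernelInB {b : stab G C (emptyIndex Γ).1} :
    b ∈ kernelInB Γ G C ↔ ∀ i (e : E i), b.1 i • e = e := by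
  simp only [kernelInB, Subgroup.mem_subgroupOf, Set.mem_univ, true_imp_iff, MulAction.toPermHom_apply,
    MulAction.toPerm_apply, Equiv.Perm.one_apply, Subgroup.mem_pi, MonoidHom.mem_ker,
    Equiv.Perm.ext_iff]

/-- Conjugates of N by H_T can be computed inside H_T, where they still act trivially on every E_i,
and these groups generate Ḡ. -/
theorem kernel_normal [Fintype I] : (kernel Γ G C).Normal := by
  constructor
  intro n hn g
  have hg : g ∈ parabolic Γ G C Finset.univ := mem_parabolic_univ g
  -- Both conjugations are carried along, so that the induction passes to inverses.
  have key : ∀ n ∈ kernel Γ G C, g * n * g⁻¹ ∈ kernel Γ G C ∧ g⁻¹ * n * g ∈ kernel Γ G C := by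
    have conj (T : DiagramIndex Γ) (x : stab G C T.1) : ∀ n ∈ kernel Γ G C,
        of Γ G C T x * n * (of Γ G C T x)⁻¹ ∈ kernel Γ G C := by
      rintro _ ⟨b, hb, rfl⟩
      have hb' := mem_kernelInB.1 hb
      have hconj : ∀ i (e : E i), (x.1 * b.1 * x.1⁻¹) i • e = e := by
        intro i e
        simp only [Pi.mul_apply, Pi.inv_apply, mul_smul, hb', smul_inv_smul]
      refine ⟨⟨x.1 * b.1 * x.1⁻¹, fun i _ => hconj i _⟩, mem_kernelInB.2 hconj, ?_⟩
      rw [← of_inclusion G C (T := emptyIndex Γ) (T' := T) (Finset.empty_subset _),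
        ← of_inclusion G C (T := emptyIndex Γ) (T' := T) (Finset.empty_subset _),
        ← map_mul, ← map_inv, ← map_mul]
      rfl
    have conj' (T : DiagramIndex Γ) (x : stab G C T.1) : ∀ n ∈ kernel Γ G C,
        of Γ G C T x * n * (of Γ G C T x)⁻¹ ∈ kernel Γ G C ∧
        (of Γ G C T x)⁻¹ * n * of Γ G C T x ∈ kernel Γ G C := fun n hn =>
      ⟨conj T x n hn, by simpa using conj T x⁻¹ n hn⟩
    clear hn
    induction hg using parabolic_induction with
    | base b => exact conj' _ b
    | single i hi a => exact conj' _ _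
    | mul g h _ _ hg hh =>
      intro n hn
      refine ⟨?_, ?_⟩
      · convert (hg _ (hh n hn).1).1 using 1; group
      · convert (hh _ (hg n hn).2).2 using 1; group
    | inv g _ hg =>
      intro n hn
      simpa using (hg n hn).symm
  exact (key n hn).1

end GenGraphProduct

end group

end GraphProd

namespace GraphProd

/-! ### The basic construction as a covering of the realization -/

namespace GenGraphProduct

variable {I : Type*} [Fintype I] (Γ : SimpleGraph I) {E : I → Type*} (G : I → Type*)
  [∀ i, Group (G i)] [∀ i, MulAction (G i) (E i)] (C : ∀ i, E i)

/-- The gluing relation on `Ḡ × K` whose quotient is the basic construction: `(g, x) ∼ (h, x)`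
iff `g` and `h` differ by the parabolic subgroup of the mirrors that contain `x`. -/
def cosetGluing : Setoid (Σ _ : GenGraphProduct Γ G C, DavisChamber Γ) where
  r a b := a.2 = b.2 ∧ a.1⁻¹ * b.1 ∈ parabolic Γ G C (mirrors a.2)
  iseqv :=
    { refl := fun a => ⟨rfl, by simp [one_mem]⟩
      symm := fun {a b} h => ⟨h.1.symm, by simpa [← h.1] using inv_mem h.2⟩
      trans := fun {a b c} h k => ⟨h.1.trans k.1, by
        have := mul_mem h.2 (h.1 ▸ k.2)
        rwa [mul_assoc, mul_inv_cancel_left] at this⟩ }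

/-- The space obtained by gluing copies of the Davis chamber indexed by the elements of the
generalized graph product. -/
def CosetSpace : Type _ := Quotient (cosetGluing Γ G C)

instance : TopologicalSpace (CosetSpace Γ G C) :=
  inferInstanceAs (TopologicalSpace (Quotient (cosetGluing Γ G C)))

namespace CosetSpace

/-- The point with coordinate `x` in the copy of the Davis chamber indexed by `g`. -/
def mk (g : GenGraphProduct Γ G C) (x : DavisChamber Γ) : CosetSpace Γ G C :=
  Quotient.mk (cosetGluing Γ G C) ⟨g, x⟩

variable {Γ G C}

theorem mk_eq_mk_iff {g h : GenGraphProduct Γ G C} {x y : DavisChamber Γ} :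
    mk Γ G C g x = mk Γ G C h y ↔ x = y ∧ g⁻¹ * h ∈ parabolic Γ G C (mirrors x) :=
  Quotient.eq (r := cosetGluing Γ G C)

theorem ind {motive : CosetSpace Γ G C → Prop} (h : ∀ g x, motive (mk Γ G C g x))
    (z : CosetSpace Γ G C) : motive z :=
  Quotient.ind (fun a => h a.1 a.2) z

theorem continuous_mk (g : GenGraphProduct Γ G C) : Continuous (mk Γ G C g) :=
  continuous_quot_mk.comp
    (continuous_sigmaMk (σ := fun _ : GenGraphProduct Γ G C => DavisChamber Γ) (i := g))

theorem continuous_iff {Y : Type*} [TopologicalSpace Y] {f : CosetSpace Γ G C → Y} :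
    Continuous f ↔ ∀ g, Continuous fun x => f (mk Γ G C g x) :=
  (isQuotientMap_quot_mk.continuous_iff (Y := CosetSpace Γ G C)).trans continuous_sigma_iff

instance : MulAction (GenGraphProduct Γ G C) (CosetSpace Γ G C) where
  smul g := Quotient.map (fun a => ⟨g * a.1, a.2⟩) fun a b h => ⟨h.1, by
    simpa [mul_assoc] using h.2⟩
  one_smul := ind fun g x => congrArg (mk Γ G C · x) (one_mul g)
  mul_smul k l := ind fun g x => congrArg (mk Γ G C · x) (mul_assoc k l g)

instance : ContinuousConstSMul (GenGraphProduct Γ G C) (CosetSpace Γ G C) where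
  continuous_const_smul k := continuous_iff.2 fun g => continuous_mk (k * g)

variable (Γ G C) in
/-- The chamber of `E` that belongs to an element of the generalized graph product. -/
def chamber (g : GenGraphProduct Γ G C) (i : I) : E i := proj Γ G C g i • C i

omit [Fintype I] in
theorem chamber_eq_iff {g h : GenGraphProduct Γ G C} {T : Finset I} :
    (∀ i ∉ T, chamber Γ G C g i = chamber Γ G C h i) ↔ proj Γ G C (g⁻¹ * h) ∈ stab G C T := by
  simp only [mem_stab, chamber, map_mul, map_inv, Pi.mul_apply, Pi.inv_apply, mul_smul,
    inv_smul_eq_iff]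
  exact forall₂_congr fun _ _ => eq_comm

variable (Γ G C) in
/-- The projection to the realization of the product building. -/
def toRealization : CosetSpace Γ G C → Realization Γ E :=
  Quotient.lift (fun a => Realization.mk Γ E (chamber Γ G C a.1) a.2) fun _ _ h =>
    Realization.mk_eq_mk_iff.2 ⟨h.1, fun i hi =>
      chamber_eq_iff.2 (proj_mem_stab h.2) i fun h' => hi (mem_mirrors.1 h')⟩

theorem toRealization_mk (g : GenGraphProduct Γ G C) (x : DavisChamber Γ) :
    toRealization Γ G C (mk Γ G C g x) = Realization.mk Γ E (chamber Γ G C g) x := rfl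

theorem chamber_surjective [∀ i, MulAction.IsPretransitive (G i) (E i)] :
    Function.Surjective (chamber Γ G C) := fun D => by
  choose x hx using fun i => MulAction.exists_smul_eq (G i) (C i) (D i)
  obtain ⟨g, rfl⟩ := proj_surjective (Γ := Γ) (C := C) x
  exact ⟨g, funext hx⟩

theorem isQuotientMap_toRealization [∀ i, MulAction.IsPretransitive (G i) (E i)] :
    Topology.IsQuotientMap (toRealization Γ G C) := by
  let f : (Σ _ : GenGraphProduct Γ G C, DavisChamber Γ) → Σ _ : (∀ i, E i), DavisChamber Γ :=
    Sigma.map (chamber Γ G C) fun _ => id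
  have hf : Topology.IsQuotientMap f := by
    refine IsOpenMap.isQuotientMap (isOpenMap_sigma_map.2 fun _ => IsOpenMap.id)
      (continuous_sigma_map.2 fun _ => continuous_id) ?_
    rintro ⟨D, x⟩
    obtain ⟨g, rfl⟩ := chamber_surjective (Γ := Γ) (G := G) (C := C) D
    exact ⟨⟨g, x⟩, rfl⟩
  have h : Topology.IsQuotientMap (toRealization Γ G C ∘ Quotient.mk (cosetGluing Γ G C)) :=
    (isQuotientMap_quot_mk (r := (gluing Γ E).r)).comp hf
  exact Topology.IsQuotientMap.of_comp continuous_quot_mk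
    (continuous_iff.2 fun g => Realization.continuous_mk (chamber Γ G C g)) h

/-- Membership respects the gluing because points with mirrors in T are only glued along parabolic
subgroups inside that of T. For T the mirrors of x, this is an open star of the point x of gK. -/
theorem exists_isOpen (T : Finset I) (g : GenGraphProduct Γ G C) :
    ∃ U : Set (CosetSpace Γ G C), IsOpen U ∧ ∀ h x,
      mk Γ G C h x ∈ U ↔ mirrors x ⊆ T ∧ g⁻¹ * h ∈ parabolic Γ G C T := by
  let U : Set (CosetSpace Γ G C) :=
    {z | Quotient.lift (s := cosetGluing Γ G C)
      (fun a => mirrors a.2 ⊆ T ∧ g⁻¹ * a.1 ∈ parabolic Γ G C T) (by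
        rintro ⟨a, x⟩ ⟨b, y⟩ ⟨hxy, h⟩
        obtain rfl : x = y := hxy
        refine propext (and_congr_right fun hT => ?_)
        have h' := parabolic_mono hT h
        rw [← Subgroup.mul_mem_cancel_right _ h', mul_assoc, mul_inv_cancel_left]) z}
  refine ⟨U, ?_, fun h x => Iff.rfl⟩
  refine (isQuotientMap_quot_mk (r := (cosetGluing Γ G C).r)).isOpen_preimage.1 ?_
  refine isOpen_sigma_iff.2 fun k => ?_
  exact (isOpen_mirrors_subset T).inter (isOpen_const (p := g⁻¹ * k ∈ parabolic Γ G C T))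

theorem isQuotientCoveringMap_toRealization [∀ i, MulAction.IsPretransitive (G i) (E i)] :
    IsQuotientCoveringMap (toRealization Γ G C) (proj Γ G C).ker where
  toIsQuotientMap := isQuotientMap_toRealization
  continuous_const_smul k := continuous_const_smul (k : GenGraphProduct Γ G C)
  apply_eq_iff_mem_orbit {z w} := by
    induction z using ind with | _ g x
    induction w using ind with | _ h y
    rw [toRealization_mk, toRealization_mk, Realization.mk_eq_mk_iff]
    constructor
    · rintro ⟨rfl, hgh⟩
      have h1 : proj Γ G C (g⁻¹ * h) ∈ stab G C (mirrors x) :=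
        chamber_eq_iff.1 fun i hi => hgh i fun h' => hi (mem_mirrors.2 h')
      -- Replacing g⁻¹h by an element k of the parabolic subgroup with the same projection gives the
      -- deck transformation gkh⁻¹, which carries the point x of hK to that of gK.
      obtain ⟨k, hk, hkp⟩ := exists_mem_parabolic (Γ := Γ) h1
      refine ⟨⟨g * k * h⁻¹, ?_⟩, ?_⟩
      · rw [MonoidHom.mem_ker, map_mul, map_mul, hkp, ← map_mul, ← map_mul]
        simp
      · change mk Γ G C (g * k * h⁻¹ * h) x = _
        rw [eq_comm, mk_eq_mk_iff]
        exact ⟨rfl, by simpa using hk⟩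
    · rintro ⟨⟨k, hk⟩, h1⟩
      have h2 : mk Γ G C (k * h) y = mk Γ G C g x := h1
      have h3 := congrArg (toRealization Γ G C) h2
      rw [toRealization_mk, toRealization_mk, eq_comm, Realization.mk_eq_mk_iff] at h3
      have h4 : chamber Γ G C (k * h) = chamber Γ G C h := by
        funext i
        simp [chamber, MonoidHom.mem_ker.1 hk]
      rwa [h4] at h3
  disjoint z := by
    induction z using ind with | _ g x
    obtain ⟨U, hU, hmem⟩ := exists_isOpen (mirrors x) g
    refine ⟨U, hU.mem_nhds ((hmem g x).2 ⟨subset_rfl, by simp [one_mem]⟩), ?_⟩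
    rintro ⟨k, hk⟩ ⟨_, ⟨w, hw, rfl⟩, hkw⟩
    induction w using ind with | _ h y
    have h1 := ((hmem h y).1 hw).2
    have h2 : g⁻¹ * (k * h) ∈ parabolic Γ G C (mirrors x) := ((hmem (k * h) y).1 hkw).2
    -- If k moves the open star to meet itself, then its conjugate lies in the parabolic subgroup of
    -- a clique and in the kernel of `proj`, so it is trivial.
    have h3 : g⁻¹ * k * g ∈ parabolic Γ G C (mirrors x) := by
      simpa [mul_assoc] using mul_mem h2 (inv_mem h1)
    have h4 := eq_one_of_mem_parabolic (isClique_mirrors x) h3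
      (by simp [MonoidHom.mem_ker.1 hk])
    refine Subtype.ext ?_
    have h5 : k = g * (g⁻¹ * k * g) * g⁻¹ := by group
    exact h5.trans (by rw [h4]; simp)

theorem joined_mk_mk (g : GenGraphProduct Γ G C) (x y : DavisChamber Γ) :
    Joined (mk Γ G C g x) (mk Γ G C g y) := by
  have H (x : DavisChamber Γ) :
      Joined (mk Γ G C g (vertex (sphericalEmpty Γ))) (mk Γ G C g x) := by
    refine ⟨⟨⟨fun t => mk Γ G C g (cone _ (t, ⟨x, mem_coface_sphericalEmpty x⟩)),
      (continuous_mk g).comp ((continuous_cone _).comp (Continuous.prodMk_left _))⟩, ?_, ?_⟩⟩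
    · simp [cone_zero]
    · simp [cone_one]
  exact (H x).symm.trans (H y)

/-- For a generator h from B or G_i, the copies gK and ghK share the vertex ∅ or {i}. Such steps are
then concatenated. -/
theorem joined_mul {T : Finset I} {h : GenGraphProduct Γ G C} (hh : h ∈ parabolic Γ G C T) :
    ∀ g x, Joined (mk Γ G C g x) (mk Γ G C (g * h) x) := by
  have glue (T : DiagramIndex Γ) (h : GenGraphProduct Γ G C) (hh : h ∈ parabolic Γ G C T.1) (g x) :
      Joined (mk Γ G C g x) (mk Γ G C (g * h) x) := by
    refine (joined_mk_mk g x (vertex T.spherical)).trans ?_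
    refine Joined.trans ?_ (joined_mk_mk (g * h) (vertex T.spherical) x)
    have : mk Γ G C g (vertex T.spherical) = mk Γ G C (g * h) (vertex T.spherical) := by
      refine mk_eq_mk_iff.2 ⟨rfl, ?_⟩
      rw [inv_mul_cancel_left]
      refine parabolic_mono (fun i hi => mem_mirrors.2 ?_) hh
      exact mem_coface_iff.1 (vertex_mem_coface le_rfl) i hi
    rw [this]
  induction hh using parabolic_induction with
  | base b => exact glue (emptyIndex Γ) _ (base_mem_parabolic _ b)
  | single i hi a =>
    exact glue (vertexIndex Γ i) _ (single_mem_parabolic (Finset.mem_singleton_self i) a)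
  | mul g h _ _ hg hh => exact fun k x => (hg k x).trans (mul_assoc k g h ▸ hh (k * g) x)
  | inv g _ hg => exact fun k x => by simpa using (hg (k * g⁻¹) x).symm

instance : PathConnectedSpace (CosetSpace Γ G C) where
  nonempty := ⟨mk Γ G C 1 (vertex (sphericalEmpty Γ))⟩
  joined z w := by
    induction z using ind with | _ g x
    induction w using ind with | _ h y
    have := joined_mul (mem_parabolic_univ (g⁻¹ * h)) g y
    rw [mul_inv_cancel_left] at this
    exact (joined_mk_mk g x y).trans this

end CosetSpace

end GenGraphProduct

end GraphProd

namespace GraphProd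

open GenGraphProduct

/-! ### Marked chambers and the right action of the generalized graph product -/

section marked

variable {I : Type*} [Fintype I] {Γ : SimpleGraph I} {E : I → Type*} (G : I → Type*)
  [∀ i, Group (G i)] [∀ i, MulAction (G i) (E i)] (C : ∀ i, E i)
  {X : Type*} [TopologicalSpace X] (q : X → Realization Γ E)

theorem mirrors_vertex (T : Spherical Γ) : mirrors (vertex T) = T.1 := by
  ext i
  rw [mem_mirrors]
  constructor
  · intro h
    refine h T ?_
    simp [vertex]
  · exact fun h => mem_coface_iff.1 (vertex_mem_coface le_rfl) i h

variable {q} in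
-- The two chambers of E have the same point at the vertex T in the realization, so the second can
-- be lifted through the given point of X.
theorem Chamber.exists_relocate (hq : IsCoveringMap q) (T : Spherical Γ) (D : Chamber q)
    (D' : ∀ i, E i) (h : ∀ i ∉ T.1, D.base i = D' i) :
    ∃ D₁ : Chamber q, D₁.base = D' ∧ D₁.map (vertex T) = D.map (vertex T) := by
  refine Chamber.exists_of_apply_eq hq D' (vertex T) _ ?_
  rw [D.lifts, Realization.mk_eq_mk_iff]
  exact ⟨rfl, fun i hi => h i fun hiT => hi (mem_mirrors.1 (mirrors_vertex T ▸ hiT))⟩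

/-- Chambers of the graph product together with an element of `∏ G i` that maps `C` to their
projection. -/
def MarkedChamber : Type _ :=
  {p : Chamber q × (∀ i, G i) // ∀ i, p.1.base i = p.2 i • C i}

namespace MarkedChamber

variable {G C q}

/-- The underlying chamber. -/
def chamber (p : MarkedChamber G C q) : Chamber q := p.1.1

/-- The marking. -/
def marking (p : MarkedChamber G C q) : ∀ i, G i := p.1.2

theorem base_chamber (p : MarkedChamber G C q) (i : I) :
    p.chamber.base i = p.marking i • C i := p.2 i

theorem ext_of_apply_eq (hq : IsCoveringMap q) {p p' : MarkedChamber G C q}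
    (h : p.marking = p'.marking) {x : DavisChamber Γ} (hx : p.chamber.map x = p'.chamber.map x) :
    p = p' :=
  Subtype.ext (Prod.ext (Chamber.ext_of_apply_eq hq
    (funext fun i => by
      change p.chamber.base i = p'.chamber.base i
      rw [base_chamber, base_chamber, h]) hx) h)

/-- Without the marking, right multiplication by x would make no sense, as a chamber of E determines
it only up to B. Since x fixes C off T, the move changes only coordinates in T. -/
theorem exists_move (hq : IsCoveringMap q) (T : DiagramIndex Γ) (x : stab G C T.1)
    (p : MarkedChamber G C q) :
    ∃ p' : MarkedChamber G C q, p'.marking = p.marking * x ∧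
      p'.chamber.map (vertex T.spherical) = p.chamber.map (vertex T.spherical) := by
  obtain ⟨D, hD, hD'⟩ := Chamber.exists_relocate hq T.spherical p.chamber
    (fun i => (p.marking * x) i • C i) fun i hi => by
      rw [base_chamber, Pi.mul_apply, mul_smul, (mem_stab G C).1 x.2 i hi]
  exact ⟨⟨⟨D, p.marking * x⟩, congrFun hD⟩, rfl, hD'⟩

/-- The right action of the groups of the diagram on the marked chambers. -/
noncomputable def move (hq : IsCoveringMap q) (T : DiagramIndex Γ) (x : stab G C T.1)
    (p : MarkedChamber G C q) : MarkedChamber G C q :=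
  (exists_move hq T x p).choose

theorem marking_move (hq : IsCoveringMap q) (T : DiagramIndex Γ) (x : stab G C T.1)
    (p : MarkedChamber G C q) : (move hq T x p).marking = p.marking * x :=
  (exists_move hq T x p).choose_spec.1

theorem map_move (hq : IsCoveringMap q) (T : DiagramIndex Γ) (x : stab G C T.1)
    (p : MarkedChamber G C q) :
    (move hq T x p).chamber.map (vertex T.spherical) = p.chamber.map (vertex T.spherical) :=
  (exists_move hq T x p).choose_spec.2

theorem move_one (hq : IsCoveringMap q) (T : DiagramIndex Γ) (p : MarkedChamber G C q) :
    move hq T 1 p = p :=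
  ext_of_apply_eq hq (by simp [marking_move]) (map_move hq T 1 p)

theorem move_mul (hq : IsCoveringMap q) (T : DiagramIndex Γ) (x y : stab G C T.1)
    (p : MarkedChamber G C q) : move hq T (x * y) p = move hq T y (move hq T x p) :=
  ext_of_apply_eq hq (x := vertex T.spherical) (by simp [marking_move, mul_assoc])
    (by rw [map_move, map_move, map_move])

/-- The chamber moved at the vertex T agrees with the old one on the whole coface of T. This
contains the vertex T', so the move at T' gives the same chamber. -/
theorem move_inclusion (hq : IsCoveringMap q) {T T' : DiagramIndex Γ} (h : T.1 ≤ T'.1)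
    (x : stab G C T.1) (p : MarkedChamber G C q) :
    move hq T' (Subgroup.inclusion (stab_mono G C h) x) p = move hq T x p := by
  refine ext_of_apply_eq hq (x := vertex T'.spherical) (by simp [marking_move]) ?_
  rw [map_move]
  refine (Chamber.eqOn_coface hq T.spherical (fun i hi => ?_) (vertex_mem_coface le_rfl)
    (map_move hq T x p)).symm (vertex_mem_coface h)
  rw [base_chamber, base_chamber, marking_move, Pi.mul_apply, mul_smul,
    (mem_stab G C).1 x.2 i hi]

/-- `move` as a homomorphism. -/
noncomputable def moveHom (hq : IsCoveringMap q) (T : DiagramIndex Γ) :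
    stab G C T.1 →* (Equiv.Perm (MarkedChamber G C q))ᵐᵒᵖ where
  toFun x := .op
    { toFun := move hq T x
      invFun := move hq T x⁻¹
      left_inv := fun p => by rw [← move_mul, mul_inv_cancel, move_one]
      right_inv := fun p => by rw [← move_mul, inv_mul_cancel, move_one] }
  map_one' := congrArg MulOpposite.op (Equiv.ext (move_one hq T))
  map_mul' x y := congrArg MulOpposite.op (Equiv.ext (move_mul hq T x y))

/-- The right action of the generalized graph product on the marked chambers. -/
noncomputable def actHom (hq : IsCoveringMap q) :
    GenGraphProduct Γ G C →* (Equiv.Perm (MarkedChamber G C q))ᵐᵒᵖ :=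
  lift Γ G C (moveHom hq) fun _ _ h x =>
    congrArg MulOpposite.op (Equiv.ext (move_inclusion hq h x))

/-- The right action of the generalized graph product on the marked chambers. -/
noncomputable def act (hq : IsCoveringMap q) (g : GenGraphProduct Γ G C)
    (p : MarkedChamber G C q) : MarkedChamber G C q :=
  (actHom hq g).unop p

theorem act_of (hq : IsCoveringMap q) (T : DiagramIndex Γ) (x : stab G C T.1)
    (p : MarkedChamber G C q) : act hq (of Γ G C T x) p = move hq T x p :=
  congrArg (fun f : (Equiv.Perm (MarkedChamber G C q))ᵐᵒᵖ => f.unop p)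
    (lift_of Γ G C (moveHom hq) _ T x)

theorem act_mul (hq : IsCoveringMap q) (g h : GenGraphProduct Γ G C)
    (p : MarkedChamber G C q) : act hq (g * h) p = act hq h (act hq g p) := by
  rw [act, map_mul]; rfl

theorem act_one (hq : IsCoveringMap q) (p : MarkedChamber G C q) : act hq 1 p = p := by
  rw [act, map_one]; rfl

theorem act_act_inv (hq : IsCoveringMap q) (g : GenGraphProduct Γ G C)
    (p : MarkedChamber G C q) : act hq g (act hq g⁻¹ p) = p := by
  rw [← act_mul, inv_mul_cancel, act_one]

theorem marking_act (hq : IsCoveringMap q) (g : GenGraphProduct Γ G C)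
    (p : MarkedChamber G C q) : (act hq g p).marking = p.marking * proj Γ G C g := by
  induction mem_parabolic_univ g using parabolic_induction generalizing p with
  | base b => rw [act_of, marking_move, proj_of]
  | single i hi a => rw [single, MonoidHom.comp_apply, act_of, marking_move, proj_of]
  | mul g h _ _ hg hh => rw [act_mul, hh, hg, map_mul, mul_assoc]
  | inv g _ hg => rw [map_inv, eq_mul_inv_iff_mul_eq, ← hg, act_act_inv]

theorem map_act (hq : IsCoveringMap q) {S : Finset I} {g : GenGraphProduct Γ G C}
    (hg : g ∈ parabolic Γ G C S) {x : DavisChamber Γ} (hx : S ⊆ mirrors x)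
    (p : MarkedChamber G C q) : (act hq g p).chamber.map x = p.chamber.map x := by
  have key (T : DiagramIndex Γ) (y : stab G C T.1) (hT : T.1 ⊆ S) (p : MarkedChamber G C q) :
      (act hq (of Γ G C T y) p).chamber.map x = p.chamber.map x := by
    rw [act_of]
    refine Chamber.eqOn_coface hq T.spherical (fun i hi => ?_) (vertex_mem_coface le_rfl)
      (map_move hq T y p) (mem_coface_iff.2 fun i hi => mem_mirrors.1 (hx (hT hi)))
    rw [base_chamber, base_chamber, marking_move, Pi.mul_apply, mul_smul,
      (mem_stab G C).1 y.2 i hi]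
  induction hg using parabolic_induction generalizing p with
  | base b => exact key _ b (Finset.empty_subset _) p
  | single i hi a => exact key (vertexIndex Γ i) _ (Finset.singleton_subset_iff.2 hi) p
  | mul g h _ _ hg hh => rw [act_mul, hh, hg]
  | inv g _ hg => rw [← hg, act_act_inv]

end MarkedChamber

end marked

/-! ### Chambers of the universal cover as cosets of B -/

section chamberOf

variable {I : Type*} [Fintype I] {Γ : SimpleGraph I} {E : I → Type*} {G : I → Type*}
  [∀ i, Group (G i)] [∀ i, MulAction (G i) (E i)] {C : ∀ i, E i}
  {X : Type*} [TopologicalSpace X] {q : X → Realization Γ E}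

/-- A chamber over `C` with the trivial marking. -/
def markedBase {D₀ : Chamber q} (h₀ : D₀.base = C) : MarkedChamber G C q :=
  ⟨⟨D₀, 1⟩, fun i => by simp [h₀]⟩

/-- The orbit map of the generalized graph product to the chambers. -/
noncomputable def chamberOf (hq : IsCoveringMap q) {D₀ : Chamber q} (h₀ : D₀.base = C)
    (g : GenGraphProduct Γ G C) : Chamber q :=
  (MarkedChamber.act hq g (markedBase h₀)).chamber

variable (hq : IsCoveringMap q) {D₀ : Chamber q} (h₀ : D₀.base = C)

theorem base_chamberOf (g : GenGraphProduct Γ G C) :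
    (chamberOf hq h₀ g).base = CosetSpace.chamber Γ G C g := by
  funext i
  rw [chamberOf, MarkedChamber.base_chamber, MarkedChamber.marking_act]
  change (1 * proj Γ G C g) i • C i = _
  rw [one_mul]; rfl

theorem chamberOf_one : chamberOf (G := G) hq h₀ 1 = D₀ := by
  rw [chamberOf, MarkedChamber.act_one]; rfl

theorem map_chamberOf_mul {S : Finset I} (g : GenGraphProduct Γ G C) {h : GenGraphProduct Γ G C}
    (hh : h ∈ parabolic Γ G C S) {x : DavisChamber Γ} (hx : S ⊆ mirrors x) :
    (chamberOf hq h₀ (g * h)).map x = (chamberOf hq h₀ g).map x := by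
  rw [chamberOf, MarkedChamber.act_mul, MarkedChamber.map_act hq hh hx]; rfl

/-- The map of the coset space to the universal cover. -/
noncomputable def cosetSpaceMap : CosetSpace Γ G C → X :=
  Quotient.lift (fun a => (chamberOf hq h₀ a.1).map a.2) (by
    rintro ⟨g, x⟩ ⟨h, y⟩ ⟨hxy, hgh⟩
    obtain rfl : x = y := hxy
    have := map_chamberOf_mul hq h₀ g hgh subset_rfl
    rw [mul_inv_cancel_left] at this
    exact this.symm)

theorem cosetSpaceMap_mk (g : GenGraphProduct Γ G C) (x : DavisChamber Γ) :
    cosetSpaceMap hq h₀ (CosetSpace.mk Γ G C g x) = (chamberOf hq h₀ g).map x := rfl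

theorem apply_cosetSpaceMap (z : CosetSpace Γ G C) :
    q (cosetSpaceMap hq h₀ z) = CosetSpace.toRealization Γ G C z := by
  induction z using CosetSpace.ind with | _ g x
  rw [cosetSpaceMap_mk, (chamberOf hq h₀ g).lifts, base_chamberOf, CosetSpace.toRealization_mk]

variable [∀ i, MulAction.IsPretransitive (G i) (E i)] [SimplyConnectedSpace X]

theorem cosetSpaceMap_bijective : Function.Bijective (cosetSpaceMap (G := G) hq h₀) :=
  IsCoveringMap.bijective_of_comp_eq
    CosetSpace.isQuotientCoveringMap_toRealization.isCoveringMap hq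
    (CosetSpace.continuous_iff.2 fun g => (chamberOf hq h₀ g).map.continuous)
    (apply_cosetSpaceMap hq h₀)

theorem map_chamberOf_eq_iff {g h : GenGraphProduct Γ G C} {x : DavisChamber Γ} :
    (chamberOf hq h₀ g).map x = (chamberOf hq h₀ h).map x ↔
      g⁻¹ * h ∈ parabolic Γ G C (mirrors x) := by
  rw [← cosetSpaceMap_mk, ← cosetSpaceMap_mk, (cosetSpaceMap_bijective hq h₀).injective.eq_iff,
    CosetSpace.mk_eq_mk_iff, eq_self_iff_true, true_and]

/-- The vertex {i} lies in no mirror but the i-th, so agreement there already forces agreement on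
the i-mirror. -/
theorem panelEquiv_chamberOf_iff {g h : GenGraphProduct Γ G C} {i : I} :
    PanelEquiv i (chamberOf hq h₀ g) (chamberOf hq h₀ h) ↔ g⁻¹ * h ∈ parabolic Γ G C {i} := by
  have hi : mirrors (vertex (vertexIndex Γ i).spherical) = {i} := mirrors_vertex _
  constructor
  · intro H
    have := (map_chamberOf_eq_iff hq h₀).1
      (H (vertex (vertexIndex Γ i).spherical) (mem_mirrors.1 (by simp [hi])))
    rwa [hi] at this
  · intro H x hx
    exact (map_chamberOf_eq_iff hq h₀).2
      (parabolic_mono (Finset.singleton_subset_iff.2 (mem_mirrors.2 hx)) H)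

theorem chamberOf_eq_iff {g h : GenGraphProduct Γ G C} :
    chamberOf hq h₀ g = chamberOf hq h₀ h ↔ g⁻¹ * h ∈ parabolic Γ G C ∅ := by
  have hv : mirrors (vertex (sphericalEmpty Γ)) = ∅ := mirrors_vertex _
  constructor
  · intro H
    have := (map_chamberOf_eq_iff hq h₀).1 (congrArg (·.map (vertex (sphericalEmpty Γ))) H)
    rwa [hv] at this
  · intro H
    refine Chamber.ext_of_apply_eq hq (x := vertex (sphericalEmpty Γ)) ?_
      ((map_chamberOf_eq_iff hq h₀).2 (parabolic_mono (Finset.empty_subset _) H))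
    rw [base_chamberOf, base_chamberOf]
    exact funext fun i => CosetSpace.chamber_eq_iff.2 (proj_mem_stab H) i (Finset.notMem_empty i)

/-- A chamber is determined by its centre, the vertex ∅, and its projection. The centre comes from
some gK and lies in no mirror, so the projections agree as well. -/
theorem chamberOf_surjective : Function.Surjective (chamberOf (G := G) hq h₀) := by
  intro D
  have hv : mirrors (vertex (sphericalEmpty Γ)) = ∅ := mirrors_vertex _
  obtain ⟨z, hz⟩ := (cosetSpaceMap_bijective (G := G) hq h₀).surjective
    (D.map (vertex (sphericalEmpty Γ)))
  induction z using CosetSpace.ind with | _ g x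
  rw [cosetSpaceMap_mk] at hz
  have h1 := congrArg q hz
  rw [(chamberOf hq h₀ g).lifts, D.lifts, Realization.mk_eq_mk_iff] at h1
  obtain ⟨rfl, h1⟩ := h1
  refine ⟨g, Chamber.ext_of_apply_eq hq (funext fun i => h1 i fun hi => ?_) hz⟩
  have := mem_mirrors.2 hi
  simp [hv] at this

/-- The chambers of the graph product are the cosets of `B`. -/
noncomputable def cosetEquiv : GenGraphProduct Γ G C ⧸ parabolic Γ G C ∅ ≃ Chamber q :=
  Equiv.ofBijective
    (Quotient.lift (s := QuotientGroup.leftRel (parabolic Γ G C ∅)) (chamberOf hq h₀)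
      fun _ _ h => (chamberOf_eq_iff hq h₀).2 (QuotientGroup.leftRel_apply.1 h))
    ⟨fun a b => by
      induction a using QuotientGroup.induction_on
      induction b using QuotientGroup.induction_on
      exact fun h => QuotientGroup.eq.2 ((chamberOf_eq_iff hq h₀).1 h),
    fun D => (chamberOf_surjective (G := G) hq h₀ D).imp' QuotientGroup.mk fun _ h => h⟩

/-! ### The homomorphism to the group of lifts, its image and its kernel -/

/-- The left action of the generalized graph product on the chambers of the graph product. -/
noncomputable def chamberPerm : GenGraphProduct Γ G C →* Equiv.Perm (Chamber q) :=
  (cosetEquiv hq h₀).permCongrHom.toMonoidHom.comp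
    (MulAction.toPermHom (GenGraphProduct Γ G C) (GenGraphProduct Γ G C ⧸ parabolic Γ G C ∅))

theorem chamberPerm_chamberOf (g h : GenGraphProduct Γ G C) :
    chamberPerm hq h₀ g (chamberOf hq h₀ h) = chamberOf hq h₀ (g * h) := by
  have h1 (k : GenGraphProduct Γ G C) :
      chamberOf hq h₀ k = cosetEquiv hq h₀ (QuotientGroup.mk k) := rfl
  rw [h1, h1]
  change cosetEquiv hq h₀ (g • (cosetEquiv (G := G) hq h₀).symm _) = _
  rw [Equiv.symm_apply_apply]
  rfl

theorem isLift_chamberPerm (g : GenGraphProduct Γ G C) :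
    IsLift (proj Γ G C g) (chamberPerm hq h₀ g) := by
  intro D i
  obtain ⟨h, rfl⟩ := chamberOf_surjective (G := G) hq h₀ D
  rw [chamberPerm_chamberOf, base_chamberOf, base_chamberOf]
  simp [CosetSpace.chamber, mul_smul]

theorem chamberPerm_mem_liftGroup (g : GenGraphProduct Γ G C) :
    chamberPerm hq h₀ g ∈ liftGroup G q := by
  refine ⟨fun i D D' => ?_, _, isLift_chamberPerm hq h₀ g⟩
  obtain ⟨h, rfl⟩ := chamberOf_surjective (G := G) hq h₀ D
  obtain ⟨h', rfl⟩ := chamberOf_surjective (G := G) hq h₀ D'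
  rw [chamberPerm_chamberOf, chamberPerm_chamberOf, panelEquiv_chamberOf_iff,
    panelEquiv_chamberOf_iff]
  simp [mul_assoc]

theorem sameResidue_chamberOf {T : Finset I} {h : GenGraphProduct Γ G C}
    (hh : h ∈ parabolic Γ G C T) : ∀ g, SameResidue T (chamberOf hq h₀ g)
      (chamberOf hq h₀ (g * h)) := by
  have symm : ∀ D D' : Chamber q, SameResidue T D D' → SameResidue T D' D := by
    intro D D' H
    induction H with
    | refl => exact .refl
    | tail _ h ih =>
      obtain ⟨i, hi, h⟩ := h
      exact .head ⟨i, hi, fun x hx => (h x hx).symm⟩ ih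
  induction hh using parabolic_induction with
  | base b =>
    intro g
    rw [(chamberOf_eq_iff hq h₀ (g := g) (h := g * base Γ G C b)).2
      (by simpa using base_mem_parabolic _ b)]
    exact .refl
  | single i hi a =>
    refine fun g => .single ⟨i, hi, (panelEquiv_chamberOf_iff hq h₀).2 ?_⟩
    simpa using single_mem_parabolic (Finset.mem_singleton_self i) a
  | mul h k _ _ hh hk =>
    exact fun g => (hh g).trans (mul_assoc g h k ▸ hk (g * h))
  | inv h _ hh =>
    exact fun g => symm _ _ (by simpa using hh (g * h⁻¹))

include hq h₀ in
/-- A lift of the identity that fixes a chamber is trivial. -/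
theorem eq_one_of_isLift_one {φ : Equiv.Perm (Chamber q)} (hφ : φ ∈ buildingAut q)
    (hlift : IsLift (1 : ∀ i, G i) φ) (hfix : φ D₀ = D₀) : φ = 1 := by
  have hbase (D : Chamber q) : (φ D).base = D.base := funext fun i => by simpa using hlift D i
  -- If φ fixes D, then φ D' shares the i-mirror of D, hence of D', and lies over the same chamber
  -- of E. So φ D' = D', and fixed chambers spread along galleries.
  have step (i : I) {D D' : Chamber q} (h : PanelEquiv i D D') (hD : φ D = D) : φ D' = D' := by
    have h1 := (hφ i D D').2 h
    have hv : vertex (vertexIndex Γ i).spherical ∈ mirror Γ i :=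
      mem_mirrors.1 (by rw [mirrors_vertex]; exact Finset.mem_singleton_self i)
    exact Chamber.ext_of_apply_eq hq (hbase D') (by rw [← h1 _ hv, hD, h _ hv])
  have key {T : Finset I} {g : GenGraphProduct Γ G C} (hg : g ∈ parabolic Γ G C T) :
      ∀ k, φ (chamberOf hq h₀ k) = chamberOf hq h₀ k →
        φ (chamberOf hq h₀ (k * g)) = chamberOf hq h₀ (k * g) := by
    intro k hk
    have := sameResidue_chamberOf hq h₀ hg k
    generalize chamberOf hq h₀ (k * g) = D at this ⊢
    induction this with
    | refl => exact hk
    | tail _ h ih => obtain ⟨i, -, h⟩ := h; exact step i h ih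
  refine Equiv.ext fun D => ?_
  obtain ⟨g, rfl⟩ := chamberOf_surjective (G := G) hq h₀ D
  simpa using key (mem_parabolic_univ g) 1 (by rw [chamberOf_one, hfix])

/-- The homomorphism of the generalized graph product to the group of lifts. -/
noncomputable def toLiftGroup : GenGraphProduct Γ G C →* liftGroup G q :=
  (chamberPerm hq h₀).codRestrict _ (chamberPerm_mem_liftGroup hq h₀)

/-- Choose g that carries D₀ to φ D₀. An element of B corrects its projection to x without changing
the image of D₀, and what remains is a lift of the identity that fixes D₀. -/
theorem toLiftGroup_surjective : Function.Surjective (toLiftGroup (G := G) hq h₀) := by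
  rintro ⟨φ, hφ, x, hx⟩
  obtain ⟨g, hg⟩ := chamberOf_surjective (G := G) hq h₀ (φ D₀)
  have hb : (proj Γ G C g)⁻¹ * x ∈ stab G C (emptyIndex Γ).1 := by
    refine (mem_stab G C).2 fun i _ => ?_
    have h1 := hx D₀ i
    rw [← hg, base_chamberOf, h₀] at h1
    rw [Pi.mul_apply, mul_smul, ← h1]
    simp [CosetSpace.chamber]
  let b : stab G C (emptyIndex Γ).1 := ⟨_, hb⟩
  have hproj : proj Γ G C (g * base Γ G C b) = x := by simp [b]
  refine ⟨g * base Γ G C b, Subtype.ext ?_⟩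
  change chamberPerm hq h₀ (g * base Γ G C b) = φ
  set ψ := chamberPerm hq h₀ (g * base Γ G C b) with hψ
  have hψD : ψ D₀ = φ D₀ := by
    have h1 := chamberPerm_chamberOf hq h₀ (g * base Γ G C b) 1
    rw [chamberOf_one, mul_one] at h1
    rw [hψ, h1, ← hg]
    exact ((chamberOf_eq_iff hq h₀).2 (by simpa using base_mem_parabolic _ b)).symm
  have h2 : ψ⁻¹ * φ = 1 := by
    refine eq_one_of_isLift_one (G := G) hq h₀
      (mul_mem (inv_mem (chamberPerm_mem_liftGroup hq h₀ _).1) hφ) (fun D i => ?_) ?_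
    · have h3 := isLift_chamberPerm hq h₀ (g * base Γ G C b) (ψ⁻¹ (φ D)) i
      rw [hproj, ← hψ, show ψ (ψ⁻¹ (φ D)) = φ D from ψ.apply_symm_apply _, hx,
        smul_left_cancel_iff] at h3
      simpa using h3.symm
    · rw [Equiv.Perm.mul_apply, ← hψD]
      exact ψ.symm_apply_apply _
  exact inv_mul_eq_one.1 h2

theorem ker_toLiftGroup : (toLiftGroup (G := G) hq h₀).ker = kernel Γ G C := by
  classical
  have hker (g : GenGraphProduct Γ G C) :
      g ∈ (toLiftGroup (G := G) hq h₀).ker ↔ chamberPerm hq h₀ g = 1 :=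
    MonoidHom.mem_ker.trans Subtype.ext_iff
  ext g
  rw [hker]
  constructor
  · intro hg
    have h1 : chamberOf (G := G) hq h₀ 1 = chamberOf hq h₀ g := by
      have := chamberPerm_chamberOf hq h₀ g 1
      rwa [hg, mul_one] at this
    rw [chamberOf_eq_iff, inv_one, one_mul, parabolic_empty] at h1
    obtain ⟨b, rfl⟩ := h1
    refine ⟨b, mem_kernelInB.2 fun i e => ?_, rfl⟩
    -- A chamber with i-th coordinate e tests the action of b on e.
    obtain ⟨h, hh⟩ := CosetSpace.chamber_surjective (Γ := Γ) (G := G) (C := C)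
      (Function.update C i e)
    have h2 := isLift_chamberPerm hq h₀ (base Γ G C b) (chamberOf hq h₀ h) i
    rw [hg, proj_of, Equiv.Perm.one_apply, base_chamberOf, hh, Function.update_self] at h2
    exact h2.symm
  · intro hg
    refine Equiv.ext fun D => ?_
    obtain ⟨h, rfl⟩ := chamberOf_surjective (G := G) hq h₀ D
    rw [chamberPerm_chamberOf, Equiv.Perm.one_apply, chamberOf_eq_iff, parabolic_empty]
    -- By normality, h⁻¹g⁻¹h lies in N and so in B, which means that gh and h give the same chamber.
    have h1 : h⁻¹ * g⁻¹ * h⁻¹⁻¹ ∈ kernel Γ G C := kernel_normal.conj_mem _ (inv_mem hg) _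
    obtain ⟨b, -, hb⟩ := h1
    exact ⟨b, by rw [hb]; group⟩

end chamberOf

/-- Start from a chamber through any point of X and correct one coordinate k at a time, passing to
another chamber through the vertex {k}. -/
theorem Chamber.exists_base_eq {I : Type*} [Fintype I] {Γ : SimpleGraph I} {E : I → Type*}
    {X : Type*} [TopologicalSpace X] [Nonempty X] {q : X → Realization Γ E} (hq : IsCoveringMap q)
    (C : ∀ i, E i) : ∃ D : Chamber q, D.base = C := by
  classical
  have key (U : Finset I) : ∃ D : Chamber q, ∀ i ∈ U, D.base i = C i := by
    induction U using Finset.induction_on with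
    | empty =>
      obtain ⟨z⟩ := ‹Nonempty X›
      obtain ⟨⟨D, x⟩, hDx⟩ := Quotient.exists_rep (q z)
      obtain ⟨D', -, -⟩ := Chamber.exists_of_apply_eq hq D x z hDx.symm
      exact ⟨D', by simp⟩
    | insert k U _ ih =>
      obtain ⟨D, hD⟩ := ih
      obtain ⟨D', hD', -⟩ := Chamber.exists_relocate hq (vertexIndex Γ k).spherical D
        (Function.update D.base k (C k)) fun i hi =>
          (Function.update_of_ne (fun h => hi (Finset.mem_singleton.2 h)) _ _).symm
      refine ⟨D', fun i hi => ?_⟩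
      rw [hD']
      by_cases h : i = k
      · subst h; simp
      · rw [Function.update_of_ne h]
        exact hD i (Finset.mem_of_mem_insert_of_ne hi h)
  obtain ⟨D, hD⟩ := key Finset.univ
  exact ⟨D, funext fun i => hD i (Finset.mem_univ i)⟩

end GraphProd

theorem mainTheorem7 {I : Type*} [Fintype I] (Γ : SimpleGraph I) (E : I → Type*) (G : I → Type*)
    [∀ i, Group (G i)] [∀ i, MulAction (G i) (E i)] [∀ i, MulAction.IsPretransitive (G i) (E i)]
    (C : ∀ i, E i)
    {X : Type*} [TopologicalSpace X] [SimplyConnectedSpace X]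
    (q : X → GraphProd.Realization Γ E) (hq : IsCoveringMap q) :
    Function.Injective (GraphProd.GenGraphProduct.of Γ G C (GraphProd.emptyIndex Γ)) ∧
    ∃ _ : (GraphProd.kernel Γ G C).Normal,
      (∃ D₀ : GraphProd.Chamber q, D₀.base = C) ∧
      ∀ D₀ : GraphProd.Chamber q, D₀.base = C →
        ∃ Φ : (GraphProd.GenGraphProduct Γ G C ⧸ GraphProd.kernel Γ G C) ≃*
            GraphProd.liftGroup G q,
          ∀ (T : GraphProd.DiagramIndex Γ) (x : GraphProd.stab G C T.1),
            GraphProd.IsLift (x : ∀ i, G i)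
                (Φ (QuotientGroup.mk (GraphProd.GenGraphProduct.of Γ G C T x))).1 ∧
            GraphProd.SameResidue T.1 D₀
              ((Φ (QuotientGroup.mk (GraphProd.GenGraphProduct.of Γ G C T x))).1 D₀) := by
  refine ⟨GraphProd.GenGraphProduct.base_injective Γ G C,
    GraphProd.GenGraphProduct.kernel_normal, GraphProd.Chamber.exists_base_eq hq C,
    fun D₀ h₀ => ?_⟩
  have := GraphProd.GenGraphProduct.kernel_normal (Γ := Γ) (G := G) (C := C)
  refine ⟨(QuotientGroup.quotientMulEquivOfEq (GraphProd.ker_toLiftGroup hq h₀).symm).trans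
    (QuotientGroup.quotientKerEquivOfSurjective _ (GraphProd.toLiftGroup_surjective hq h₀)),
    fun T x => ⟨?_, ?_⟩⟩
  · have := GraphProd.isLift_chamberPerm hq h₀ (GraphProd.GenGraphProduct.of Γ G C T x)
    rw [GraphProd.GenGraphProduct.proj_of] at this
    exact this
  · have h1 := GraphProd.chamberPerm_chamberOf hq h₀ (GraphProd.GenGraphProduct.of Γ G C T x) 1
    have h2 := GraphProd.sameResidue_chamberOf hq h₀
      (GraphProd.GenGraphProduct.of_mem_parabolic T x) 1
    rw [one_mul, ← mul_one (GraphProd.GenGraphProduct.of Γ G C T x), ← h1,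
      GraphProd.chamberOf_one] at h2
    exact h2
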